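/- **Setting.** A *BAUML model* is a tuple $\mathcal B=\langle \mathcal M,\mathcal O,\mathcal S,\mathcal P\rangle$, where * $\mathcal M$ is a UML class diagram: classes with an acyclic is-a relation, string and boolean attributes (each of multiplicity one), and binary associations with cardinality constraints. Some classes are *artifacts*; each artifact $A$ is the top class of its own hierarchy, and each instance of $A$ belongs to exactly one leaf of that hierarchy, its current state. * $\mathcal O$ is a finite set of OCL constraints over $\mathcal M$. * $\mathcal S$ contains one state transition diagram for each artifact $A$. Its states are the leaves of the hierarchy of $A$; it has an initial state, a designated *proper termination state* $T_A$, initial transitions (which create an instance of $A$ in the initial state), and transitions between states; each transition is labelled by an event and an OCL condition. * $\mathcal P$ contains exactly one activity diagram for each event, built from an initial node, atomic tasks, decision/merge nodes with OCL guards, fork/join nodes and final nodes. Each task has an operation contract, i.e. an OCL precondition and an OCL postcondition, with input parameters that are supplied nondeterministically. The model is *unrestricted*: the OCL expressions in it may have arbitrary shape (well-typed expressions built from variables, string constants, $C.allInstances()$, attributes, navigation of associations in both directions, $oclAsType$, select, collect, union, intersection, difference, Boolean connectives, equality, inclusion, emptiness, exists, $oclIsTypeOf$, $oclIsKindOf$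 and, in postconditions, $oclIsNew$ and $@pre$). Data come from a countably infinite unordered domain and can only be compared for equality. **Execution.** A state of the system consists of a finite information base (an instance of $\mathcal M$) and of the activities that are currently running, each with its position and its artifact instance. The system starts from the empty information base (which is assumed to satisfy $\mathcal O$) with no running activity. In one step, an initial transition is started, or a transition is started for an existing artifact instance that is in its source state and takes part in no other transition, provided that its condition holds; or a running activity makes one move of its control flow, executes one task, or ends, the instance then being in the target state of the transition. A task can be executed, for some values of its parameters, if its precondition holds; it leads to an information base that conforms to $\mathcal M$, satisfies $\mathcal O$ and satisfies the postcondition. We consider two readings of postconditions: the *permissive* one, in which every such information base may result, and the *inertial* one, in which moreover the set of facts that change has to be minimal with respect to inclusion among the information bases that are possible for the same inputs and the same returned object. **Artifact termination.** $\mathcal B$ *satisfies artifact termination* if the initial state of the transition system so obtained satisfies $$\nu Z.\Big(\bigwedge_{A}\ \forall x.\,A(x)\rightarrow \mu Y.\,\big(T_A(x)\lor (A(x)\land\langle-\rangle Y)\big)\Big)\land[-]Z ,$$ where $A$ ranges over the artifacts of $\mathcal B$, $\langle-\rangle Y$ means that some successor state satisfies $Y$, and $[-]Z$ that all successor states satisfy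 $Z$; that is, whenever an instance $x$ of an artifact $A$ is present in a reachable state, the system can evolve so that $x$ persists as an instance of $A$ until it reaches the termination state $T_A$. **Theorem.** Checking artifact termination over unrestricted BAUML models is undecidable: under each of the two readings of postconditions, there is no algorithm (no computable function $f$ from codes of models to $\{\mathrm{true},\mathrm{false}\}$, for an explicit injective coding of models by natural numbers) that, for every well-formed BAUML model $\mathcal B$, decides whether $\mathcal B$ satisfies artifact termination. -/

import Mathlib

namespace BAUML

/-! ### Data, information bases

Object identifiers and strings are two copies of a countably infinite unordered set (natural
numbers serve as names; expressions can only test for equality). Classes, attributes and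
associations are named by natural numbers. -/

inductive Val : Type
  | obj (o : ℕ)
  | str (v : ℕ)

/-- Ground facts: `o` is an instance of class `c`; attribute `a` of `o` has value `v`;
association `r` links `o` to `o'`. -/
inductive Fact : Type
  | inst (c o : ℕ)
  | attr (a o v : ℕ)
  | link (r o o' : ℕ)
  deriving DecidableEq

/-- An information base is a finite set of facts. -/
abbrev Snapshot := Finset Fact

/-- `o` occurs in the information base as an instance of some class. -/
def Snapshot.Live (s : Snapshot) (o : ℕ) : Prop := ∃ c, Fact.inst c o ∈ s

/-! ### Class diagrams -/

/-- A string attribute (a boolean one if `isBool`) of class `owner`. -/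
structure Attribute where
  owner : ℕ
  isBool : Bool

/-- A cardinality constraint `lo..hi`; `none` is the upper bound `*`. -/
structure Mult where
  lo : ℕ
  hi : Option ℕ

/-- A binary association from class `dom` to class `img`. Each object of `dom` is linked to
`imgMult` objects of `img`, each object of `img` to `domMult` objects of `dom`. -/
structure Association where
  dom : ℕ
  img : ℕ
  domMult : Mult
  imgMult : Mult

/-- The classes are `0, …, numClasses - 1`; `(c, d) ∈ isa` says that `c` is a direct subclass of
`d`; an attribute or association is named by its position in the list. -/
structure ClassDiagram where
  numClasses : ℕ
  isa : List (ℕ × ℕ)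
  attrs : List Attribute
  assocs : List Association

namespace ClassDiagram

/-- `c = d`, or `c` is a direct or indirect subclass of `d`. -/
def IsA (D : ClassDiagram) : ℕ → ℕ → Prop :=
  Relation.ReflTransGen fun c d => (c, d) ∈ D.isa

/-- `c` is a leaf of the hierarchy with top class `A`. -/
def IsLeaf (D : ClassDiagram) (A c : ℕ) : Prop :=
  D.IsA c A ∧ ∀ d, (d, c) ∉ D.isa

structure WellFormed (D : ClassDiagram) : Prop where
  isa_lt : ∀ p ∈ D.isa, p.1 < D.numClasses ∧ p.2 < D.numClasses
  isa_acyclic : ∀ c, ¬ Relation.TransGen (fun c d => (c, d) ∈ D.isa) c c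
  attr_lt : ∀ a ∈ D.attrs, a.owner < D.numClasses
  assoc_lt : ∀ r ∈ D.assocs, r.dom < D.numClasses ∧ r.img < D.numClasses
  mult_le : ∀ r ∈ D.assocs,
    (∀ h ∈ r.domMult.hi, r.domMult.lo ≤ h) ∧ (∀ h ∈ r.imgMult.hi, r.imgMult.lo ≤ h)

end ClassDiagram

def Mult.Allows (m : Mult) (X : Set ℕ) : Prop :=
  (m.lo : ℕ∞) ≤ X.encard ∧ ∀ h ∈ m.hi, X.encard ≤ (h : ℕ∞)

/-- `s` is an instance of the class diagram `D` in which the classes `arts` are artifacts. Boolean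
attributes take one of the two special strings `0` and `1`. Every instance of an artifact is in
exactly one of the leaf subclasses of the artifact (its current state). -/
structure Snapshot.Legal (D : ClassDiagram) (arts : List ℕ) (s : Snapshot) : Prop where
  class_lt : ∀ c o, Fact.inst c o ∈ s → c < D.numClasses
  isa : ∀ c d o, (c, d) ∈ D.isa → Fact.inst c o ∈ s → Fact.inst d o ∈ s
  attr_typed : ∀ a o v, Fact.attr a o v ∈ s →
    ∃ d, D.attrs[a]? = some d ∧ Fact.inst d.owner o ∈ s ∧ (d.isBool = true → v = 0 ∨ v = 1)
  attr_value : ∀ a (d : Attribute), D.attrs[a]? = some d → ∀ o, Fact.inst d.owner o ∈ s →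
    ∃! v, Fact.attr a o v ∈ s
  link_typed : ∀ r o o', Fact.link r o o' ∈ s →
    ∃ d, D.assocs[r]? = some d ∧ Fact.inst d.dom o ∈ s ∧ Fact.inst d.img o' ∈ s
  img_mult : ∀ r (d : Association), D.assocs[r]? = some d → ∀ o, Fact.inst d.dom o ∈ s →
    d.imgMult.Allows {o' | Fact.link r o o' ∈ s}
  dom_mult : ∀ r (d : Association), D.assocs[r]? = some d → ∀ o', Fact.inst d.img o' ∈ s →
    d.domMult.Allows {o | Fact.link r o o' ∈ s}
  state : ∀ A ∈ arts, ∀ o, Fact.inst A o ∈ s → ∃! c, D.IsLeaf A c ∧ Fact.inst c o ∈ s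

/-! ### OCL expressions -/

/-- `self` is the artifact instance in scope, `result` the object returned by an operation,
`param i` the `i`-th input of an operation, `it x` an iterator variable. -/
inductive Var : Type
  | self
  | result
  | param (i : ℕ)
  | it (x : ℕ)
  deriving DecidableEq

inductive Kind : Type
  | coll
  | bool

/-- OCL expressions: collections (a single object or string is a one-element collection) and
conditions. A flag `atPre = true` is the suffix `@pre`; `inv = true` navigates an association from
its image to its domain. `collect e x e'` is `e->collect(x | e')`, of which navigation along a path
is a special case; `ex e x φ` is `e->exists(x | φ)`, and `forAll`, `or`, `implies`, `notEmpty` are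
expressed through negation. -/
inductive Expr : Kind → Type
  | var (x : Var) : Expr .coll
  | lit (v : ℕ) : Expr .coll
  | allInstances (c : ℕ) (atPre : Bool) : Expr .coll
  | attr (e : Expr .coll) (a : ℕ) (atPre : Bool) : Expr .coll
  | nav (e : Expr .coll) (r : ℕ) (inv atPre : Bool) : Expr .coll
  | asType (e : Expr .coll) (c : ℕ) : Expr .coll
  | select (e : Expr .coll) (x : ℕ) (φ : Expr .bool) : Expr .coll
  | collect (e : Expr .coll) (x : ℕ) (e' : Expr .coll) : Expr .coll
  | union (e e' : Expr .coll) : Expr .coll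
  | inter (e e' : Expr .coll) : Expr .coll
  | diff (e e' : Expr .coll) : Expr .coll
  | tt : Expr .bool
  | not (φ : Expr .bool) : Expr .bool
  | and (φ ψ : Expr .bool) : Expr .bool
  | eq (e e' : Expr .coll) : Expr .bool
  | includesAll (e e' : Expr .coll) : Expr .bool
  | isEmpty (e : Expr .coll) : Expr .bool
  | ex (e : Expr .coll) (x : ℕ) (φ : Expr .bool) : Expr .bool
  | isNew (e : Expr .coll) : Expr .bool
  | isTypeOf (e : Expr .coll) (c : ℕ) : Expr .bool
  | isKindOf (e : Expr .coll) (c : ℕ) : Expr .bool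

/-- OCL conditions. -/
abbrev Cond := Expr .bool

/-- A partial assignment of values to variables. -/
abbrev Env := Var → Option Val

abbrev Den : Kind → Type
  | .coll => Set Val
  | .bool => Prop

/-- The value of an expression over the class diagram `D`, in the information base `cur`, where
`pre` is the information base before the operation. An undefined variable is the empty
collection. -/
def Expr.eval (D : ClassDiagram) (pre cur : Snapshot) : {k : Kind} → Expr k → Env → Den k
  | _, .var x, ρ => ({v | ρ x = some v} : Set Val)
  | _, .lit v, _ => ({Val.str v} : Set Val)
  | _, .allInstances c t, _ =>
      ({v | ∃ o, v = Val.obj o ∧ Fact.inst c o ∈ bif t then pre else cur} : Set Val)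
  | _, .attr e a t, ρ =>
      ({v | ∃ o w, v = Val.str w ∧ Val.obj o ∈ (e.eval D pre cur ρ : Set Val) ∧
        Fact.attr a o w ∈ bif t then pre else cur} : Set Val)
  | _, .nav e r inv t, ρ =>
      ({v | ∃ o o', v = Val.obj o' ∧ Val.obj o ∈ (e.eval D pre cur ρ : Set Val) ∧
        (bif inv then Fact.link r o' o else Fact.link r o o') ∈ bif t then pre else cur} : Set Val)
  | _, .asType e c, ρ =>
      ({v | v ∈ (e.eval D pre cur ρ : Set Val) ∧ ∃ o, v = Val.obj o ∧ Fact.inst c o ∈ cur} :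
        Set Val)
  | _, .select e x φ, ρ =>
      ({v | v ∈ (e.eval D pre cur ρ : Set Val) ∧
        (φ.eval D pre cur (Function.update ρ (.it x) (some v)) : Prop)} : Set Val)
  | _, .collect e x e', ρ =>
      ({w | ∃ v ∈ (e.eval D pre cur ρ : Set Val),
        w ∈ (e'.eval D pre cur (Function.update ρ (.it x) (some v)) : Set Val)} : Set Val)
  | _, .union e e', ρ => ((e.eval D pre cur ρ : Set Val) ∪ (e'.eval D pre cur ρ : Set Val) : Set Val)
  | _, .inter e e', ρ => ((e.eval D pre cur ρ : Set Val) ∩ (e'.eval D pre cur ρ : Set Val) : Set Val)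
  | _, .diff e e', ρ => ((e.eval D pre cur ρ : Set Val) \ (e'.eval D pre cur ρ : Set Val) : Set Val)
  | _, .tt, _ => True
  | _, .not φ, ρ => ¬ (φ.eval D pre cur ρ : Prop)
  | _, .and φ ψ, ρ => (φ.eval D pre cur ρ : Prop) ∧ (ψ.eval D pre cur ρ : Prop)
  | _, .eq e e', ρ => (e.eval D pre cur ρ : Set Val) = (e'.eval D pre cur ρ : Set Val)
  | _, .includesAll e e', ρ => (e'.eval D pre cur ρ : Set Val) ⊆ (e.eval D pre cur ρ : Set Val)
  | _, .isEmpty e, ρ => (e.eval D pre cur ρ : Set Val) = (∅ : Set Val)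
  | _, .ex e x φ, ρ => ∃ v ∈ (e.eval D pre cur ρ : Set Val),
      (φ.eval D pre cur (Function.update ρ (.it x) (some v)) : Prop)
  | _, .isNew e, ρ => ∃ o, (e.eval D pre cur ρ : Set Val) = {Val.obj o} ∧
      ¬ pre.Live o ∧ cur.Live o
  | _, .isTypeOf e c, ρ => ∃ o, (e.eval D pre cur ρ : Set Val) = {Val.obj o} ∧
      Fact.inst c o ∈ cur ∧ ∀ d, (d, c) ∈ D.isa → Fact.inst d o ∉ cur
  | _, .isKindOf e c, ρ => ∃ o, (e.eval D pre cur ρ : Set Val) = {Val.obj o} ∧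
      Fact.inst c o ∈ cur

/-- Truth of a postcondition, in the information bases before and after the operation. -/
def Cond.HoldsPost (D : ClassDiagram) (pre cur : Snapshot) (φ : Cond) (ρ : Env) : Prop :=
  Expr.eval D pre cur φ ρ

/-- Truth of a condition in one information base. -/
def Cond.Holds (D : ClassDiagram) (s : Snapshot) (φ : Cond) (ρ : Env) : Prop :=
  Expr.eval D s s φ ρ

/-! ### Typing of OCL expressions -/

inductive Ty : Type
  | str
  | cls (c : ℕ)
  | bool

def Ty.Le (D : ClassDiagram) : Ty → Ty → Prop
  | .str, .str => True
  | .cls c, .cls d => D.IsA c d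
  | .bool, .bool => True
  | _, _ => False

/-- `e` is a well-typed expression over `D` that can be given the type `τ` (for a collection, the
type of its elements; a supertype is allowed). Only postconditions (`post = true`) may use `@pre`
and `oclIsNew`. -/
def Expr.HasTy (D : ClassDiagram) (post : Bool) :
    {k : Kind} → Expr k → (Var → Option Ty) → Ty → Prop
  | _, .var x, Γ, τ => ∃ σ, Γ x = some σ ∧ σ.Le D τ
  | _, .lit _, _, τ => τ = .str
  | _, .allInstances c t, _, τ => (t = true → post = true) ∧ c < D.numClasses ∧ Ty.Le D (.cls c) τ
  | _, .attr e a t, Γ, τ => (t = true → post = true) ∧ τ = .str ∧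
      ∃ d, D.attrs[a]? = some d ∧ e.HasTy D post Γ (.cls d.owner)
  | _, .nav e r inv t, Γ, τ => (t = true → post = true) ∧
      ∃ d, D.assocs[r]? = some d ∧
        e.HasTy D post Γ (.cls (bif inv then d.img else d.dom)) ∧
        Ty.Le D (.cls (bif inv then d.dom else d.img)) τ
  | _, .asType e c, Γ, τ => c < D.numClasses ∧ Ty.Le D (.cls c) τ ∧
      ∃ d, e.HasTy D post Γ (.cls d) ∧ D.IsA c d
  | _, .select e x φ, Γ, τ => e.HasTy D post Γ τ ∧
      ∃ σ, e.HasTy D post Γ σ ∧ φ.HasTy D post (Function.update Γ (.it x) (some σ)) .bool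
  | _, .collect e x e', Γ, τ =>
      ∃ σ, e.HasTy D post Γ σ ∧ e'.HasTy D post (Function.update Γ (.it x) (some σ)) τ
  | _, .union e e', Γ, τ => e.HasTy D post Γ τ ∧ e'.HasTy D post Γ τ
  | _, .inter e e', Γ, τ => e.HasTy D post Γ τ ∧ e'.HasTy D post Γ τ
  | _, .diff e e', Γ, τ => e.HasTy D post Γ τ ∧ e'.HasTy D post Γ τ
  | _, .tt, _, τ => τ = .bool
  | _, .not φ, Γ, τ => τ = .bool ∧ φ.HasTy D post Γ .bool
  | _, .and φ ψ, Γ, τ => τ = .bool ∧ φ.HasTy D post Γ .bool ∧ ψ.HasTy D post Γ .bool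
  | _, .eq e e', Γ, τ => τ = .bool ∧ ∃ σ, e.HasTy D post Γ σ ∧ e'.HasTy D post Γ σ
  | _, .includesAll e e', Γ, τ => τ = .bool ∧ ∃ σ, e.HasTy D post Γ σ ∧ e'.HasTy D post Γ σ
  | _, .isEmpty e, Γ, τ => τ = .bool ∧ ∃ σ, e.HasTy D post Γ σ
  | _, .ex e x φ, Γ, τ => τ = .bool ∧
      ∃ σ, e.HasTy D post Γ σ ∧ φ.HasTy D post (Function.update Γ (.it x) (some σ)) .bool
  | _, .isNew e, Γ, τ => τ = .bool ∧ post = true ∧ ∃ d, e.HasTy D post Γ (.cls d)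
  | _, .isTypeOf e c, Γ, τ => τ = .bool ∧ c < D.numClasses ∧
      ∃ d, e.HasTy D post Γ (.cls d) ∧ D.IsA c d
  | _, .isKindOf e c, Γ, τ => τ = .bool ∧ c < D.numClasses ∧
      ∃ d, e.HasTy D post Γ (.cls d) ∧ D.IsA c d

/-! ### Operation contracts, activity diagrams, state transition diagrams, models -/

/-- The operation contract of an atomic task. A parameter is a string (`none`) or an instance of
class `c` (`some c`); its value is supplied by the environment at each execution. The artifact
instance in scope is an implicit further parameter. If `creates`, the task creates and returns the
artifact instance that is in scope from then on. -/
structure Contract where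
  params : List (Option ℕ)
  creates : Bool
  pre : Cond
  post : Cond

/-- Nodes of an activity diagram, with the names of the incoming and outgoing edges: initial node,
atomic task, diamond (decision and merge, with guards on the outgoing edges), bar (fork and join),
activity-final node. -/
inductive Node : Type
  | initial (out : ℕ)
  | task (inn out : ℕ) (K : Contract)
  | choice (ins : List ℕ) (outs : List (ℕ × Cond))
  | bar (ins outs : List ℕ)
  | final (inn : ℕ)

def Node.ins : Node → List ℕ
  | .initial _ => []
  | .task i _ _ => [i]
  | .choice is _ => is
  | .bar is _ => is
  | .final i => [i]

def Node.outs : Node → List ℕ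
  | .initial o => [o]
  | .task _ o _ => [o]
  | .choice _ os => os.map Prod.fst
  | .bar _ os => os
  | .final _ => []

abbrev Activity := List Node

/-- The state transition diagram of the artifact class `artifact`, with initial state `init` and
proper termination state `term`. Its states are the leaves of the hierarchy of the artifact. Its
events are the positions in the list `activities`, which gives the activity diagram of each event.
`initTrans` lists the initial transitions (event, condition), which lead to `init`; `trans` lists
the transitions (source, event, condition, target). -/
structure Chart where
  artifact : ℕ
  init : ℕ
  term : ℕ
  initTrans : List (ℕ × Cond)
  trans : List (ℕ × ℕ × Cond × ℕ)
  activities : List Activity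

/-- A BAUML model: class diagram, OCL constraints, one state transition diagram for each artifact,
and (inside the latter) one activity diagram for each event. The artifacts are the classes that
have a state transition diagram. -/
structure Model where
  diagram : ClassDiagram
  constraints : List Cond
  charts : List Chart

def Model.arts (B : Model) : List ℕ := B.charts.map Chart.artifact

/-! ### Well-formed models -/

/-- Types of the variables in a condition in the scope of an artifact of class `A`. -/
def scopeCtx (A : ℕ) : Var → Option Ty
  | .self => some (.cls A)
  | _ => none

def Contract.ctx (K : Contract) (A : ℕ) (post : Bool) : Var → Option Ty
  | .self => some (.cls A)
  | .result => if K.creates = true ∧ post = true then some (.cls A) else none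
  | .param i => K.params[i]?.map fun p => p.elim Ty.str Ty.cls
  | .it _ => none

structure Contract.WellFormed (D : ClassDiagram) (A : ℕ) (K : Contract) : Prop where
  params_lt : ∀ c, some c ∈ K.params → c < D.numClasses
  pre_typed : Expr.HasTy D false K.pre (K.ctx A false) .bool
  post_typed : Expr.HasTy D true K.post (K.ctx A true) .bool

def Node.WellFormed (D : ClassDiagram) (A : ℕ) : Node → Prop
  | .initial _ => True
  | .task _ _ K => K.WellFormed D A
  | .choice is os => is ≠ [] ∧ os ≠ [] ∧ ∀ p ∈ os, Expr.HasTy D false p.2 (scopeCtx A) .bool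
  | .bar is _ => is ≠ []
  | .final _ => True

/-- There is exactly one initial node, and every edge has exactly one source and one target. -/
structure Activity.WellFormed (D : ClassDiagram) (A : ℕ) (P : Activity) : Prop where
  node : ∀ N ∈ P, N.WellFormed D A
  initial : ∃! i : ℕ, ∃ o, P[i]? = some (Node.initial o)
  outs_nodup : (P.flatMap Node.outs).Nodup
  ins_nodup : (P.flatMap Node.ins).Nodup
  connected : ∀ e, e ∈ P.flatMap Node.outs ↔ e ∈ P.flatMap Node.ins

structure Chart.WellFormed (D : ClassDiagram) (S : Chart) : Prop where
  artifact_lt : S.artifact < D.numClasses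
  artifact_top : ∀ d, (S.artifact, d) ∉ D.isa
  init_leaf : D.IsLeaf S.artifact S.init
  term_leaf : D.IsLeaf S.artifact S.term
  initTrans : ∀ p ∈ S.initTrans, p.1 < S.activities.length ∧
    Expr.HasTy D false p.2 (fun _ => none) .bool
  trans : ∀ t ∈ S.trans, D.IsLeaf S.artifact t.1 ∧ t.2.1 < S.activities.length ∧
    Expr.HasTy D false t.2.2.1 (scopeCtx S.artifact) .bool ∧ D.IsLeaf S.artifact t.2.2.2
  activity : ∀ P ∈ S.activities, Activity.WellFormed D S.artifact P
  /-- Artifact instances are created in the activity diagrams of initial transitions only. -/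
  creates : ∀ t ∈ S.trans, ∀ P, S.activities[t.2.1]? = some P →
    ∀ i o K, Node.task i o K ∈ P → K.creates = false

/-- The empty environment. -/
def emptyEnv : Env := fun _ => none

structure Model.WellFormed (B : Model) : Prop where
  diagram : B.diagram.WellFormed
  constraints : ∀ φ ∈ B.constraints, Expr.HasTy B.diagram false φ (fun _ => none) .bool
  /-- The initial (empty) information base satisfies the constraints. -/
  constraints_empty : ∀ φ ∈ B.constraints, Cond.Holds B.diagram ∅ φ emptyEnv
  charts : ∀ S ∈ B.charts, S.WellFormed B.diagram
  /-- There is one state transition diagram per artifact. -/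
  arts_nodup : B.arts.Nodup
  /-- Different artifacts have disjoint hierarchies. -/
  arts_disjoint : ∀ A ∈ B.arts, ∀ A' ∈ B.arts, ∀ c,
    B.diagram.IsA c A → B.diagram.IsA c A' → A = A'

/-! ### Execution -/

/-- A running activity: the activity diagram `act` is executed for a transition with target state
`target` of an artifact of class `artifact`; `self` is the artifact instance in scope (`none` until
the instance has been created), `marking` the multiset of edges that carry a token. -/
structure Run where
  artifact : ℕ
  act : Activity
  target : ℕ
  self : Option ℕ
  marking : Multiset ℕ

/-- A state of the system: the information base and the running activities. -/
structure Config where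
  snap : Snapshot
  runs : Multiset Run

/-- The environment in which only the artifact instance in scope is defined. -/
def scopeEnv (self : Option ℕ) : Env
  | .self => self.map Val.obj
  | _ => none

def taskEnv (self result : Option ℕ) (args : List Val) : Env
  | .self => self.map Val.obj
  | .result => result.map Val.obj
  | .param i => args[i]?
  | .it _ => none

/-- `v` is a possible input for a parameter: a string, or an instance of the given class. -/
def ArgOk (s : Snapshot) : Option ℕ → Val → Prop
  | none, v => ∃ w, v = Val.str w
  | some c, v => ∃ o, v = Val.obj o ∧ Fact.inst c o ∈ s

/-- Two readings of a postcondition. `permissive`: the task may lead to every legal information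
base that satisfies it. `inertial`: moreover the information base changes no more than it has to,
i.e., the set of changed facts is minimal with respect to inclusion. -/
inductive FrameRule : Type
  | permissive
  | inertial

/-- `s'` is a legal information base that satisfies the constraints of the model and, with respect
to `s`, the postcondition of `K`; the returned artifact instance, if any, exists in it. -/
def Contract.Post (B : Model) (A : ℕ) (K : Contract) (self result : Option ℕ) (args : List Val)
    (s s' : Snapshot) : Prop :=
  s'.Legal B.diagram B.arts ∧
  (∀ φ ∈ B.constraints, Cond.Holds B.diagram s' φ emptyEnv) ∧
  (∀ r ∈ result, Fact.inst A r ∈ s') ∧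
  Cond.HoldsPost B.diagram s s' K.post (taskEnv self result args)

def Contract.Effect (B : Model) (fr : FrameRule) (A : ℕ) (K : Contract) (self result : Option ℕ)
    (args : List Val) (s s' : Snapshot) : Prop :=
  K.Post B A self result args s s' ∧
  (fr = .inertial → ∀ s'' : Snapshot, K.Post B A self result args s s'' →
    symmDiff s s'' ⊆ symmDiff s s' → s'' = s')

/-- The task with contract `K`, executed with the artifact instance `self` (of class `A`) in scope
and with some inputs, leads from `s` to `s'` and leaves `self'` in scope. -/
def Contract.Exec (B : Model) (fr : FrameRule) (A : ℕ) (K : Contract) (self self' : Option ℕ)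
    (s s' : Snapshot) : Prop :=
  (∀ o ∈ self, Fact.inst A o ∈ s) ∧
  ∃ args : List Val, List.Forall₂ (ArgOk s) K.params args ∧
    Cond.Holds B.diagram s K.pre (taskEnv self none args) ∧
    ((K.creates = false ∧ self' = self ∧ K.Effect B fr A self none args s s') ∨
     (K.creates = true ∧ self = none ∧
       ∃ r, ¬ s.Live r ∧ self' = some r ∧ K.Effect B fr A none (some r) args s s'))

/-- One step of the system. Activities of different artifact instances are interleaved; an artifact
instance takes part in at most one transition at a time. -/
inductive Step (B : Model) (fr : FrameRule) : Config → Config → Prop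
  /-- An initial transition is started. -/
  | launch {s : Snapshot} {R : Multiset Run} {S : Chart} {ε e : ℕ} {φ : Cond} {P : Activity}
      (hS : S ∈ B.charts) (ht : (ε, φ) ∈ S.initTrans) (hP : S.activities[ε]? = some P)
      (hφ : Cond.Holds B.diagram s φ emptyEnv) (he : Node.initial e ∈ P) :
      Step B fr ⟨s, R⟩ ⟨s, ⟨S.artifact, P, S.init, none, {e}⟩ ::ₘ R⟩
  /-- A transition is started for an artifact instance that is in its source state. -/
  | start {s : Snapshot} {R : Multiset Run} {S : Chart} {v ε v' e o : ℕ} {φ : Cond} {P : Activity}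
      (hS : S ∈ B.charts) (ht : (v, ε, φ, v') ∈ S.trans) (hP : S.activities[ε]? = some P)
      (hA : Fact.inst S.artifact o ∈ s) (hv : Fact.inst v o ∈ s)
      (hidle : ∀ p ∈ R, p.self ≠ some o)
      (hφ : Cond.Holds B.diagram s φ (scopeEnv (some o))) (he : Node.initial e ∈ P) :
      Step B fr ⟨s, R⟩ ⟨s, ⟨S.artifact, P, v', some o, {e}⟩ ::ₘ R⟩
  | task {s s' : Snapshot} {R : Multiset Run} {A t i o : ℕ} {P : Activity}
      {self self' : Option ℕ} {m : Multiset ℕ} {K : Contract}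
      (hN : Node.task i o K ∈ P) (hK : K.Exec B fr A self self' s s')
      (hfresh : ∀ r ∈ self', ∀ p ∈ R, p.self ≠ some r) :
      Step B fr ⟨s, ⟨A, P, t, self, i ::ₘ m⟩ ::ₘ R⟩ ⟨s', ⟨A, P, t, self', o ::ₘ m⟩ ::ₘ R⟩
  | choice {s : Snapshot} {R : Multiset Run} {A t i o : ℕ} {P : Activity}
      {self : Option ℕ} {m : Multiset ℕ} {is : List ℕ} {os : List (ℕ × Cond)} {φ : Cond}
      (hN : Node.choice is os ∈ P) (hi : i ∈ is) (ho : (o, φ) ∈ os)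
      (hφ : Cond.Holds B.diagram s φ (scopeEnv self)) :
      Step B fr ⟨s, ⟨A, P, t, self, i ::ₘ m⟩ ::ₘ R⟩ ⟨s, ⟨A, P, t, self, o ::ₘ m⟩ ::ₘ R⟩
  | bar {s : Snapshot} {R : Multiset Run} {A t : ℕ} {P : Activity}
      {self : Option ℕ} {m : Multiset ℕ} {is os : List ℕ} (hN : Node.bar is os ∈ P) :
      Step B fr ⟨s, ⟨A, P, t, self, (is : Multiset ℕ) + m⟩ ::ₘ R⟩
        ⟨s, ⟨A, P, t, self, (os : Multiset ℕ) + m⟩ ::ₘ R⟩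
  /-- The activity ends, and with it the transition; the instance must be in the target state. -/
  | finish {s : Snapshot} {R : Multiset Run} {A t i o : ℕ} {P : Activity} {m : Multiset ℕ}
      (hN : Node.final i ∈ P) (ht : Fact.inst t o ∈ s) :
      Step B fr ⟨s, ⟨A, P, t, some o, i ::ₘ m⟩ ::ₘ R⟩ ⟨s, R⟩

/-- The system starts from the empty information base, with no running activity. -/
def initialConfig : Config := ⟨∅, 0⟩

/-! ### Artifact termination -/

/-- The states that satisfy `μY. T(x) ∨ (A(x) ∧ ⟨-⟩Y)`. -/
def reachesTerm (B : Model) (fr : FrameRule) (A T x : ℕ) : Set Config :=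
  OrderHom.lfp
    { toFun := fun Y => {c | Fact.inst T x ∈ c.snap ∨
        (Fact.inst A x ∈ c.snap ∧ ∃ c', Step B fr c c' ∧ c' ∈ Y)}
      monotone' := by
        rintro Y Y' hY c (h | ⟨h, c', hc, hc'⟩)
        · exact Or.inl h
        · exact Or.inr ⟨h, c', hc, hY hc'⟩ }

/-- The states that satisfy the artifact termination property
`νZ. (⋀_A ∀ x. A(x) → μY. T_A(x) ∨ (A(x) ∧ ⟨-⟩Y)) ∧ [-]Z`. -/
def terminationProperty (B : Model) (fr : FrameRule) : Set Config :=
  OrderHom.gfp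
    { toFun := fun Z => {c | (∀ S ∈ B.charts, ∀ x, Fact.inst S.artifact x ∈ c.snap →
        c ∈ reachesTerm B fr S.artifact S.term x) ∧ ∀ c', Step B fr c c' → c' ∈ Z}
      monotone' := by
        rintro Z Z' hZ c ⟨h, hc⟩
        exact ⟨h, fun c' hc' => hZ (hc c' hc')⟩ }

/-- The model satisfies the artifact termination property. -/
def Model.Terminates (B : Model) (fr : FrameRule) : Prop :=
  initialConfig ∈ terminationProperty B fr

/-! ### Models as natural numbers

The inputs of a decision procedure are the code numbers of models. -/

open Encodable

def Var.code : Var → ℕ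
  | .self => Nat.pair 0 0
  | .result => Nat.pair 1 0
  | .param i => Nat.pair 2 i
  | .it x => Nat.pair 3 x

def Expr.code : {k : Kind} → Expr k → ℕ
  | _, .var x => Nat.pair 0 x.code
  | _, .lit v => Nat.pair 1 v
  | _, .allInstances c t => Nat.pair 2 (encode (c, t))
  | _, .attr e a t => Nat.pair 3 (encode (e.code, a, t))
  | _, .nav e r inv t => Nat.pair 4 (encode (e.code, r, inv, t))
  | _, .asType e c => Nat.pair 5 (encode (e.code, c))
  | _, .select e x φ => Nat.pair 6 (encode (e.code, x, φ.code))
  | _, .collect e x e' => Nat.pair 7 (encode (e.code, x, e'.code))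
  | _, .union e e' => Nat.pair 8 (encode (e.code, e'.code))
  | _, .inter e e' => Nat.pair 9 (encode (e.code, e'.code))
  | _, .diff e e' => Nat.pair 10 (encode (e.code, e'.code))
  | _, .tt => Nat.pair 11 0
  | _, .not φ => Nat.pair 12 φ.code
  | _, .and φ ψ => Nat.pair 13 (encode (φ.code, ψ.code))
  | _, .eq e e' => Nat.pair 14 (encode (e.code, e'.code))
  | _, .includesAll e e' => Nat.pair 15 (encode (e.code, e'.code))
  | _, .isEmpty e => Nat.pair 16 e.code
  | _, .ex e x φ => Nat.pair 17 (encode (e.code, x, φ.code))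
  | _, .isNew e => Nat.pair 18 e.code
  | _, .isTypeOf e c => Nat.pair 19 (encode (e.code, c))
  | _, .isKindOf e c => Nat.pair 20 (encode (e.code, c))

def Attribute.code (a : Attribute) : ℕ := encode (a.owner, a.isBool)

def Mult.code (m : Mult) : ℕ := encode (m.lo, m.hi)

def Association.code (r : Association) : ℕ :=
  encode (r.dom, r.img, r.domMult.code, r.imgMult.code)

def ClassDiagram.code (D : ClassDiagram) : ℕ :=
  encode (D.numClasses, D.isa, D.attrs.map Attribute.code, D.assocs.map Association.code)

def Contract.code (K : Contract) : ℕ := encode (K.params, K.creates, K.pre.code, K.post.code)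

def Node.code : Node → ℕ
  | .initial o => Nat.pair 0 o
  | .task i o K => Nat.pair 1 (encode (i, o, K.code))
  | .choice is os => Nat.pair 2 (encode (is, os.map fun p => (p.1, Expr.code p.2)))
  | .bar is os => Nat.pair 3 (encode (is, os))
  | .final i => Nat.pair 4 i

def Activity.code (P : Activity) : ℕ := encode (P.map Node.code)

def Chart.code (S : Chart) : ℕ :=
  encode (S.artifact, S.init, S.term, S.initTrans.map (fun p => (p.1, Expr.code p.2)),
    S.trans.map (fun t => (t.1, t.2.1, Expr.code t.2.2.1, t.2.2.2)),
    S.activities.map Activity.code)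

def Model.code (B : Model) : ℕ :=
  encode (B.diagram.code, B.constraints.map Expr.code, B.charts.map Chart.code)

/-! Different models have different codes. -/

theorem Var.code_injective : Function.Injective Var.code := by
  intro x y h
  cases x <;> cases y <;> simp_all [Var.code, Nat.pair_eq_pair]

theorem Expr.code_injective {k : Kind} : Function.Injective (Expr.code : Expr k → ℕ) := by
  intro e
  induction e with
  | var x =>
    intro e' h
    cases e' <;> simp only [Expr.code, Nat.pair_eq_pair] at h <;> first
      | omega
      | rw [Var.code_injective h.2]
  | _ =>
    intro e' h
    cases e' <;> simp only [Expr.code, Nat.pair_eq_pair, encode_inj, Prod.mk.injEq] at h <;> first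
      | omega
      | grind

theorem Attribute.code_injective : Function.Injective Attribute.code := by
  rintro ⟨⟩ ⟨⟩ h
  simpa [Attribute.code] using h

theorem Mult.code_injective : Function.Injective Mult.code := by
  rintro ⟨⟩ ⟨⟩ h
  simpa [Mult.code] using h

theorem Association.code_injective : Function.Injective Association.code := by
  rintro ⟨⟩ ⟨⟩ h
  simpa [Association.code, Mult.code_injective.eq_iff] using h

theorem ClassDiagram.code_injective : Function.Injective ClassDiagram.code := by
  rintro ⟨⟩ ⟨⟩ h
  simpa [ClassDiagram.code, (List.map_injective_iff.2 Attribute.code_injective).eq_iff,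
    (List.map_injective_iff.2 Association.code_injective).eq_iff] using h

theorem Contract.code_injective : Function.Injective Contract.code := by
  rintro ⟨⟩ ⟨⟩ h
  simpa [Contract.code, Expr.code_injective.eq_iff] using h

theorem guarded_injective :
    Function.Injective fun p : ℕ × Cond => (p.1, Expr.code p.2) := by
  rintro ⟨⟩ ⟨⟩ h
  simpa [Expr.code_injective.eq_iff] using h

theorem Node.code_injective : Function.Injective Node.code := by
  intro M N h
  cases M <;> cases N <;> simp only [Node.code, Nat.pair_eq_pair] at h <;> first
    | omega
    | simpa [Contract.code_injective.eq_iff,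
        (List.map_injective_iff.2 guarded_injective).eq_iff] using h

theorem Activity.code_injective : Function.Injective Activity.code :=
  encode_injective.comp (List.map_injective_iff.2 Node.code_injective)

theorem Chart.code_injective : Function.Injective Chart.code := by
  have ht : Function.Injective
      fun t : ℕ × ℕ × Cond × ℕ => (t.1, t.2.1, Expr.code t.2.2.1, t.2.2.2) := by
    rintro ⟨_, _, _, _⟩ ⟨_, _, _, _⟩ h
    simpa [Expr.code_injective.eq_iff] using h
  rintro ⟨⟩ ⟨⟩ h
  simpa [Chart.code, (List.map_injective_iff.2 guarded_injective).eq_iff,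
    (List.map_injective_iff.2 ht).eq_iff,
    (List.map_injective_iff.2 Activity.code_injective).eq_iff] using h

theorem Model.code_injective : Function.Injective Model.code := by
  rintro ⟨⟩ ⟨⟩ h
  simpa [Model.code, ClassDiagram.code_injective.eq_iff,
    (List.map_injective_iff.2 Expr.code_injective).eq_iff,
    (List.map_injective_iff.2 Chart.code_injective).eq_iff] using h

end BAUML

/-!
A closed first-order formula over finite structures can be written as an OCL constraint on the
objects of one class. For a formula `φ`, take the model whose constraint forbids artifact instances
in the termination state unless the information base contains a model of `φ`. Its two tasks only
say what happens to the artifact instances, so the rest of the information base can be guessed: an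
artifact instance can terminate if and only if `φ` has a finite model. The minimal change required
by the inertial reading does not interfere, as below every possible result of a task there is a
minimal one.

Finite satisfiability is undecidable (Trakhtenbrot). Here the finite structures are initial segments
of the natural numbers with an order, successor, unpairing, and one relation for each of finitely
many codes of partial recursive functions. The axioms say that each pair in such a relation comes
from a last step of a computation that uses other pairs, so by induction the relations are contained
in the graphs of the functions; conversely a converging computation fits into a segment that is long
enough. So whether the function with code `c` is defined at `n` amounts to finite satisfiability of
a formula that is primitive recursive in `n`.
-/

namespace BAUML

open Nat.Partrec (Code)
open Encodable

/-! ### First-order formulas over finite structures -/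

/-- First-order formulas over binary relation symbols `0, 1, 2, …`. Variables are named, because
OCL iterator variables are. -/
inductive Formula : Type
  | rel (r x y : ℕ)
  | same (x y : ℕ)
  | not (φ : Formula)
  | and (φ ψ : Formula)
  | or (φ ψ : Formula)
  | imp (φ ψ : Formula)
  | all (x : ℕ) (φ : Formula)
  | ex (x : ℕ) (φ : Formula)

namespace Formula

/-- Truth in the structure with carrier `α` and relations `q 0, q 1, …` under the assignment `v`. -/
def Realize {α : Type*} (q : ℕ → α → α → Prop) : Formula → (ℕ → α) → Prop
  | rel r x y, v => q r (v x) (v y)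
  | same x y, v => v x = v y
  | not φ, v => ¬ φ.Realize q v
  | and φ ψ, v => φ.Realize q v ∧ ψ.Realize q v
  | or φ ψ, v => φ.Realize q v ∨ ψ.Realize q v
  | imp φ ψ, v => φ.Realize q v → ψ.Realize q v
  | all x φ, v => ∀ a, φ.Realize q (Function.update v x a)
  | ex x φ, v => ∃ a, φ.Realize q (Function.update v x a)

/-- Truth of `φ` in some nonempty finite structure, under some assignment. -/
def HasFiniteModel (φ : Formula) : Prop :=
  ∃ (N : ℕ) (q : ℕ → Fin N → Fin N → Prop) (v : ℕ → Fin N), φ.Realize q v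

/-- The relation symbols of the formula are among `0, …, M - 1` and its free variables are in
`V`. -/
def Over (M : ℕ) : Formula → Set ℕ → Prop
  | rel r x y, V => r < M ∧ x ∈ V ∧ y ∈ V
  | same x y, V => x ∈ V ∧ y ∈ V
  | not φ, V => φ.Over M V
  | and φ ψ, V | or φ ψ, V | imp φ ψ, V => φ.Over M V ∧ ψ.Over M V
  | all x φ, V | ex x φ, V => φ.Over M (insert x V)

/-- The formula as an OCL condition on the objects of class `u`, with associations as relations. -/
def toOCL (u : ℕ) : Formula → Cond
  | rel r x y => .includesAll (.nav (.var (.it x)) r false false) (.var (.it y))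
  | same x y => .eq (.var (.it x)) (.var (.it y))
  | not φ => .not (φ.toOCL u)
  | and φ ψ => .and (φ.toOCL u) (ψ.toOCL u)
  | or φ ψ => .not (.and (.not (φ.toOCL u)) (.not (ψ.toOCL u)))
  | imp φ ψ => .not (.and (φ.toOCL u) (.not (ψ.toOCL u)))
  | all x φ => .not (.ex (.allInstances u false) x (.not (φ.toOCL u)))
  | ex x φ => .ex (.allInstances u false) x (φ.toOCL u)

theorem hasTy_toOCL {D : ClassDiagram} {u M : ℕ} (hu : u < D.numClasses)
    (hD : ∀ r < M, ∃ d, D.assocs[r]? = some d ∧ d.dom = u ∧ d.img = u) {φ : Formula} {V : Set ℕ}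
    {Γ : Var → Option Ty} (hφ : φ.Over M V) (hΓ : ∀ x ∈ V, Γ (.it x) = some (.cls u)) :
    Expr.HasTy D false (φ.toOCL u) Γ .bool := by
  have extend {x : ℕ} {V : Set ℕ} {Γ : Var → Option Ty}
      (hΓ : ∀ y ∈ V, Γ (.it y) = some (.cls u)) :
      ∀ y ∈ insert x V, Function.update Γ (.it x) (some (.cls u)) (.it y) = some (.cls u) := by
    intro y hy
    by_cases hyx : y = x
    · simp [hyx]
    · simpa [Function.update_apply, hyx] using hΓ y (hy.resolve_left hyx)
  have cls_le : Ty.Le D (.cls u) (.cls u) := Relation.ReflTransGen.refl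
  have hasTy_var {x : ℕ} {V : Set ℕ} {Γ : Var → Option Ty} (hx : x ∈ V)
      (hΓ : ∀ y ∈ V, Γ (.it y) = some (.cls u)) :
      Expr.HasTy D false (.var (.it x)) Γ (.cls u) := ⟨_, hΓ x hx, cls_le⟩
  induction φ generalizing V Γ with
  | rel r x y =>
    obtain ⟨hr, hx, hy⟩ := hφ
    obtain ⟨d, hd, hdom, himg⟩ := hD r hr
    refine ⟨rfl, .cls u, ⟨Bool.noConfusion, d, hd, ?_, ?_⟩, hasTy_var hy hΓ⟩
    · simpa only [cond_false, hdom] using hasTy_var hx hΓ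
    · simpa only [cond_false, himg] using cls_le
  | same x y => exact ⟨rfl, _, hasTy_var hφ.1 hΓ, hasTy_var hφ.2 hΓ⟩
  | not φ ih => exact ⟨rfl, ih hφ hΓ⟩
  | and φ ψ ihφ ihψ => exact ⟨rfl, ihφ hφ.1 hΓ, ihψ hφ.2 hΓ⟩
  | or φ ψ ihφ ihψ => exact ⟨rfl, rfl, ⟨rfl, ihφ hφ.1 hΓ⟩, rfl, ihψ hφ.2 hΓ⟩
  | imp φ ψ ihφ ihψ => exact ⟨rfl, rfl, ihφ hφ.1 hΓ, rfl, ihψ hφ.2 hΓ⟩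
  | all x φ ih =>
    exact ⟨rfl, rfl, _, ⟨Bool.noConfusion, hu, cls_le⟩, rfl, ih hφ (extend hΓ)⟩
  | ex x φ ih => exact ⟨rfl, _, ⟨Bool.noConfusion, hu, cls_le⟩, ih hφ (extend hΓ)⟩

end Formula

/-- The objects of class `u`, with the associations `0, …, M - 1`, form a copy of the structure with
relations `q`, in which `e a` is the object that stands for `a`. -/
structure Snapshot.Represents {α : Type*} (s : Snapshot) (u M : ℕ) (q : ℕ → α → α → Prop)
    (e : α → ℕ) : Prop where
  injective : Function.Injective e
  inst_iff : ∀ o, Fact.inst u o ∈ s ↔ o ∈ Set.range e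
  link_iff : ∀ r < M, ∀ a b, Fact.link r (e a) (e b) ∈ s ↔ q r a b

theorem Snapshot.exists_represents (s : Snapshot) (u M : ℕ) :
    ∃ (N : ℕ) (q : ℕ → Fin N → Fin N → Prop) (e : Fin N → ℕ), s.Represents u M q e := by
  have hfin : {o | Fact.inst u o ∈ s}.Finite :=
    s.finite_toSet.preimage fun _ _ _ _ h => (Fact.inst.inj h).2
  obtain ⟨N, e, he⟩ := hfin.fin_embedding
  exact ⟨N, fun r a b => Fact.link r (e a) (e b) ∈ s, e, e.injective,
    fun o => (Set.ext_iff.1 he o).symm, fun _ _ _ _ => Iff.rfl⟩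

section Semantics

variable {D : ClassDiagram} {s : Snapshot} {u M : ℕ} {α : Type*} {q : ℕ → α → α → Prop}
  {e : α → ℕ}

theorem Snapshot.Represents.holds_ex_iff (hs : s.Represents u M q e) {φ : Cond} {x : ℕ}
    {ρ : Env} : Cond.Holds D s (.ex (.allInstances u false) x φ) ρ ↔
      ∃ a, Cond.Holds D s φ (Function.update ρ (.it x) (some (.obj (e a)))) := by
  constructor
  · rintro ⟨_, ⟨o, rfl, ho⟩, h⟩
    obtain ⟨a, rfl⟩ := (hs.inst_iff o).1 ho
    exact ⟨a, h⟩
  · rintro ⟨a, h⟩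
    exact ⟨_, ⟨_, rfl, (hs.inst_iff _).2 ⟨a, rfl⟩⟩, h⟩

theorem Formula.holds_toOCL_iff (hs : s.Represents u M q e) {φ : Formula} {V : Set ℕ}
    {v : ℕ → α} {ρ : Env} (hφ : φ.Over M V) (hρ : ∀ x ∈ V, ρ (.it x) = some (.obj (e (v x)))) :
    Cond.Holds D s (φ.toOCL u) ρ ↔ φ.Realize q v := by
  have extend {x : ℕ} {V : Set ℕ} {v : ℕ → α} {ρ : Env}
      (hρ : ∀ y ∈ V, ρ (.it y) = some (.obj (e (v y)))) (a : α) :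
      ∀ y ∈ insert x V, Function.update ρ (.it x) (some (.obj (e a))) (.it y) =
        some (.obj (e (Function.update v x a y))) := by
    intro y hy
    by_cases hyx : y = x
    · simp [hyx]
    · simpa [Function.update_apply, hyx] using hρ y (hy.resolve_left hyx)
  induction φ generalizing V v ρ with
  | rel r x y =>
    obtain ⟨hr, hx, hy⟩ := hφ
    simp [toOCL, Cond.Holds, Expr.eval, Realize, hρ x hx, hρ y hy, hs.link_iff r hr]
  | same x y =>
    simp [toOCL, Cond.Holds, Expr.eval, Realize, hρ x hφ.1, hρ y hφ.2, hs.injective.eq_iff]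
  | not φ ih => exact not_congr (ih hφ hρ)
  | and φ ψ ihφ ihψ => exact and_congr (ihφ hφ.1 hρ) (ihψ hφ.2 hρ)
  | or φ ψ ihφ ihψ =>
    exact (not_congr (and_congr (not_congr (ihφ hφ.1 hρ)) (not_congr (ihψ hφ.2 hρ)))).trans
      or_iff_not_and_not.symm
  | imp φ ψ ihφ ihψ =>
    exact (not_congr (and_congr (ihφ hφ.1 hρ) (not_congr (ihψ hφ.2 hρ)))).trans not_and_not_right
  | all x φ ih =>
    have holds_not_ex : Cond.Holds D s (.ex (.allInstances u false) x (.not (φ.toOCL u))) ρ ↔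
        ∃ a, ¬ φ.Realize q (Function.update v x a) :=
      hs.holds_ex_iff.trans (exists_congr fun a => not_congr (ih hφ (extend hρ a)))
    exact (not_congr holds_not_ex).trans not_exists_not
  | ex x φ ih => exact hs.holds_ex_iff.trans (exists_congr fun a => ih hφ (extend hρ a))

end Semantics

/-! ### Computations in finite initial segments of arithmetic -/

namespace Arith

/-- The symbol for the strict order. -/
abbrev lt : ℕ := 0
/-- The symbol for the graph of the successor. -/
abbrev succ : ℕ := 1
/-- The symbol for zero; the unary predicate is encoded as the diagonal of a binary relation. -/
abbrev zero : ℕ := 2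
/-- The symbol for the graph of the first component of `Nat.unpair`. -/
abbrev left : ℕ := 3
/-- The symbol for the graph of the second component of `Nat.unpair`. -/
abbrev right : ℕ := 4
/-- The symbol for the graph of the partial recursive function with code `c`. -/
abbrev graph (c : Code) : ℕ := encode c + 5

section Axioms

variable {α : Type*} (q : ℕ → α → α → Prop)

/-- `(a, b)` follows `(a', b')` in the order in which `Nat.unpair` enumerates the pairs. -/
def Next (a' b' a b : α) : Prop :=
  (q succ a' a ∧ q lt a b' ∧ b = b') ∨ (q succ a' b' ∧ a = b' ∧ q zero b b) ∨
  (q lt b' a' ∧ a = a' ∧ q succ b' b) ∨ (a' = b' ∧ q zero a a ∧ q succ a' b)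

/-- First-order axioms for an initial segment of the natural numbers, in which `left` and `right`
are the components of `Nat.unpair`. The successor of the last element, and pairs that are too large,
may be missing. -/
structure IsSegment : Prop where
  irrefl : ∀ a, ¬ q lt a a
  trans : ∀ a b c, q lt a b → q lt b c → q lt a c
  total : ∀ a b, a = b ∨ q lt a b ∨ q lt b a
  succ_spec : ∀ a b, q succ a b → q lt a b ∧ ¬ ∃ c, q lt a c ∧ q lt c b
  zero_spec : ∀ a, q zero a a → ¬ ∃ b, q lt b a
  left_total : ∀ n, ∃ a, q left n a
  right_total : ∀ n, ∃ a, q right n a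
  unpair : ∀ n a b, q left n a ∧ q right n b →
    (q zero n n ∧ q zero a a ∧ q zero b b) ∨
      ∃ n' a' b', q succ n' n ∧ q left n' a' ∧ q right n' b' ∧ Next q a' b' a b

/-- The last step of a computation of `b` from `a` with the code `c`, the values used in it being
recorded in the relations `graph`. -/
def Rule (c : Code) (a b : α) : Prop :=
  match c with
  | .zero => q zero b b
  | .succ => q succ a b
  | .left => q left a b
  | .right => q right a b
  | .pair f g => ∃ x y, q (graph f) a x ∧ q (graph g) a y ∧ q left b x ∧ q right b y
  | .comp f g => ∃ x, q (graph g) a x ∧ q (graph f) x b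
  | .prec f g => ∃ x y, q left a x ∧ q right a y ∧
      ((q zero y y ∧ q (graph f) x b) ∨
        ∃ z p i r t, q succ z y ∧ q left p x ∧ q right p z ∧ q (graph (.prec f g)) p i ∧
          q left r z ∧ q right r i ∧ q left t x ∧ q right t r ∧ q (graph g) t b)
  | .rfind' f => ∃ x, q (graph f) a x ∧
      ((q zero x x ∧ q right a b) ∨
        ∃ d z m m' p, q succ d x ∧ q left a z ∧ q right a m ∧ q succ m m' ∧ q left p z ∧
          q right p m' ∧ q (graph (.rfind' f)) p b)

/-- Every pair in the relation `graph c` is the result of a computation step. -/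
def ObeysRule (c : Code) : Prop := ∀ a b, q (graph c) a b → Rule q c a b

/-- The position of `a` in the segment, as a natural number. -/
noncomputable def value (a : α) : ℕ := {b | q lt b a}.ncard

/-- The relation `graph c` is part of the graph of the function with code `c`. -/
def Sound (c : Code) : Prop := ∀ a b, q (graph c) a b → value q b ∈ c.eval (value q a)

end Axioms

theorem unpair_succ (n : ℕ) : (n + 1).unpair =
    if n.unpair.1 < n.unpair.2 then
      if n.unpair.1 + 1 < n.unpair.2 then (n.unpair.1 + 1, n.unpair.2) else (n.unpair.2, 0)
    else if n.unpair.2 < n.unpair.1 then (n.unpair.1, n.unpair.2 + 1) else (0, n.unpair.1 + 1) := by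
  obtain ⟨⟨a, b⟩, rfl⟩ : ∃ p : ℕ × ℕ, n = Nat.pair p.1 p.2 := ⟨n.unpair, (Nat.pair_unpair n).symm⟩
  simp only [Nat.unpair_pair]
  rw [← Nat.pairEquiv_symm_apply, Equiv.symm_apply_eq, Nat.pairEquiv_apply]
  simp only [Function.uncurry, Nat.pair]
  split_ifs <;> first | omega | grind

section Value

variable {α : Type*} [Finite α] {q : ℕ → α → α → Prop}

theorem value_le_card (a : α) : value q a ≤ Nat.card α := Set.ncard_le_card _

namespace IsSegment

variable (h : IsSegment q)
include h

theorem value_zero {a : α} (hz : q zero a a) : value q a = 0 :=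
  (Set.ncard_eq_zero).2 (Set.eq_empty_of_forall_notMem fun b hb => h.zero_spec a hz ⟨b, hb⟩)

theorem value_succ {a b : α} (hs : q succ a b) : value q b = value q a + 1 := by
  obtain ⟨hab, hgap⟩ := h.succ_spec a b hs
  have below_succ : {c | q lt c b} = insert a {c | q lt c a} := by
    ext c
    refine ⟨fun hcb => ?_, ?_⟩
    · exact (h.total c a).imp_right fun hca => hca.resolve_right fun hac => hgap ⟨c, hac, hcb⟩
    · rintro (rfl | hca)
      exacts [hab, h.trans c a b hca hab]
  rw [value, below_succ]
  exact Set.ncard_insert_of_notMem (s := {c | q lt c a}) (h.irrefl a)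

theorem value_lt {a b : α} (hab : q lt a b) : value q a < value q b :=
  Set.ncard_lt_ncard ((Set.ssubset_iff_of_subset fun c hca => h.trans c a b hca hab).2
    ⟨a, hab, h.irrefl a⟩)

theorem unpair_succ_eq_of_next {n : ℕ} {a' b' a b : α} (hn : n.unpair = (value q a', value q b'))
    (hnext : Next q a' b' a b) : (n + 1).unpair = (value q a, value q b) := by
  rw [unpair_succ, hn]
  rcases hnext with ⟨hsucc, hlt, rfl⟩ | ⟨hsucc, rfl, hzero⟩ | ⟨hlt, rfl, hsucc⟩ |
    ⟨rfl, hzero, hsucc⟩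
  · have := h.value_succ hsucc
    have := h.value_lt hlt
    rw [if_pos (by omega), if_pos (by omega)]
    simp [*]
  · have := h.value_succ hsucc
    rw [if_pos (by omega), if_neg (by omega), h.value_zero hzero]
  · have := h.value_lt hlt
    rw [if_neg (by omega), if_pos (by omega), h.value_succ hsucc]
  · rw [if_neg (by omega), if_neg (by omega), h.value_zero hzero, h.value_succ hsucc]

theorem unpair_value {n a b : α} (hl : q left n a) (hr : q right n b) :
    (value q n).unpair = (value q a, value q b) := by
  induction hk : value q n generalizing n a b with
  | zero =>
    rcases h.unpair n a b ⟨hl, hr⟩ with ⟨-, hza, hzb⟩ | ⟨n', _, _, hs, _⟩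
    · rw [h.value_zero hza, h.value_zero hzb, Nat.unpair_zero]
      rfl
    · simp [h.value_succ hs] at hk
  | succ k ih =>
    rcases h.unpair n a b ⟨hl, hr⟩ with ⟨hz, -⟩ | ⟨n', a', b', hs, hl', hr', hnext⟩
    · simp [h.value_zero hz] at hk
    · exact h.unpair_succ_eq_of_next (ih hl' hr' (by simpa [h.value_succ hs] using hk)) hnext

theorem value_left {n a : α} (hl : q left n a) : (value q n).unpair.1 = value q a := by
  obtain ⟨b, hr⟩ := h.right_total n
  rw [h.unpair_value hl hr]

theorem value_right {n b : α} (hr : q right n b) : (value q n).unpair.2 = value q b := by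
  obtain ⟨a, hl⟩ := h.left_total n
  rw [h.unpair_value hl hr]

theorem value_pair {n a b : α} (hl : q left n a) (hr : q right n b) :
    value q n = Nat.pair (value q a) (value q b) := by
  rw [← h.value_left hl, ← h.value_right hr, Nat.pair_unpair]

end IsSegment

end Value

theorem mem_eval_rfind'_zero {f : Code} {a m : ℕ} (h : 0 ∈ f.eval (Nat.pair a m)) :
    m ∈ (Code.rfind' f).eval (Nat.pair a m) := by
  obtain ⟨_ | k, hk⟩ := Code.evaln_complete.1 h
  · simp [Code.evaln] at hk
  have hbound := Nat.le_of_lt_succ (Code.evaln_bound hk)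
  rw [Option.mem_def] at hk
  exact Code.evaln_complete.2 ⟨k + 1, by simp [Code.evaln, hbound, hk]⟩

theorem mem_eval_rfind'_succ {f : Code} {a m x b : ℕ} (h : x + 1 ∈ f.eval (Nat.pair a m))
    (hb : b ∈ (Code.rfind' f).eval (Nat.pair a (m + 1))) :
    b ∈ (Code.rfind' f).eval (Nat.pair a m) := by
  obtain ⟨k, hk⟩ := Code.evaln_complete.1 h
  obtain ⟨l, hl⟩ := Code.evaln_complete.1 hb
  replace hk := Code.evaln_mono ((le_max_left k l).trans (Nat.le_succ _)) hk
  replace hl := Code.evaln_mono (le_max_right k l) hl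
  have hbound := Nat.le_of_lt_succ (Code.evaln_bound hk)
  rw [Option.mem_def] at hk hl
  exact Code.evaln_complete.2 ⟨max k l + 1, by simp [Code.evaln, hbound, hk, hl]⟩

namespace IsSegment

variable {α : Type*} [Finite α] {q : ℕ → α → α → Prop} {f g : Code}

theorem sound_pair (h : IsSegment q) (hf : Sound q f) (hg : Sound q g)
    (hrule : ObeysRule q (.pair f g)) : Sound q (.pair f g) := by
  intro a b hab
  obtain ⟨x, y, hax, hay, hbx, hby⟩ := hrule a b hab
  simp only [Code.eval, Seq.seq, Part.map_eq_map, Part.mem_bind_iff, Part.mem_map_iff]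
  exact ⟨_, ⟨_, hf a x hax, rfl⟩, _, hg a y hay, (h.value_pair hbx hby).symm⟩

theorem sound_prec (h : IsSegment q) (hf : Sound q f) (hg : Sound q g)
    (hrule : ObeysRule q (.prec f g)) : Sound q (.prec f g) := by
  intro a
  induction hk : (value q a).unpair.2 using Nat.strong_induction_on generalizing a with
  | _ k ih =>
  subst hk
  intro b hab
  obtain ⟨x, y, hax, hay, ⟨hy, hxb⟩ | ⟨z, p, i, r, t, hzy, hpx, hpz, hpi, hrz, hri, htx, htr, htb⟩⟩
    := hrule a b hab
  · rw [h.value_pair hax hay, h.value_zero hy, Code.eval_prec_zero]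
    exact hf x b hxb
  · have previous : value q i ∈ (Code.prec f g).eval (Nat.pair (value q x) (value q z)) := by
      rw [← h.value_pair hpx hpz]
      refine ih _ ?_ p rfl i hpi
      rw [h.value_right hpz, h.value_right hay, h.value_succ hzy]
      exact Nat.lt_succ_self _
    have last := hg t b htb
    rw [h.value_pair htx htr, h.value_pair hrz hri] at last
    rw [h.value_pair hax hay, h.value_succ hzy, Code.eval_prec_succ]
    exact Part.mem_bind_iff.2 ⟨_, previous, last⟩

/-- The search for a root of `f` proceeds upwards, hence the induction on the distance of the
argument from the end of the segment. -/
theorem sound_rfind' (h : IsSegment q) (hf : Sound q f) (hrule : ObeysRule q (.rfind' f)) :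
    Sound q (.rfind' f) := by
  intro a
  induction hk : Nat.card α - (value q a).unpair.2 using Nat.strong_induction_on
    generalizing a with
  | _ k ih =>
  subst hk
  intro b hab
  obtain ⟨x, hax, ⟨hx, hab'⟩ | ⟨d, z, m, m', p, hdx, haz, ham, hmm', hpz, hpm', hpb⟩⟩ :=
    hrule a b hab
  · obtain ⟨z, haz⟩ := h.left_total a
    have root := hf a x hax
    rw [h.value_zero hx, h.value_pair haz hab'] at root
    rw [h.value_pair haz hab']
    exact mem_eval_rfind'_zero root
  · have search : value q b ∈ (Code.rfind' f).eval (Nat.pair (value q z) (value q m + 1)) := by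
      rw [← h.value_succ hmm', ← h.value_pair hpz hpm']
      refine ih _ ?_ p rfl b hpb
      have := value_le_card (q := q) m'
      rw [h.value_right hpm', h.value_right ham]
      have := h.value_succ hmm'
      omega
    have nonroot := hf a x hax
    rw [h.value_pair haz ham, h.value_succ hdx] at nonroot
    rw [h.value_pair haz ham]
    exact mem_eval_rfind'_succ nonroot search

theorem sound (h : IsSegment q) {m : ℕ} (hrules : ∀ c, encode c < m → ObeysRule q c) (c : Code)
    (hc : encode c < m) : Sound q c := by
  induction c with
  | zero =>
    intro a b hab
    simp [Code.eval, pure, PFun.pure, h.value_zero (hrules _ hc a b hab)]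
  | succ => exact fun a b hab => by simp [Code.eval, h.value_succ (hrules _ hc a b hab)]
  | left => exact fun a b hab => by simp [Code.eval, h.value_left (hrules _ hc a b hab)]
  | right => exact fun a b hab => by simp [Code.eval, h.value_right (hrules _ hc a b hab)]
  | pair f g ihf ihg =>
    obtain ⟨hf, hg⟩ := Code.encode_lt_pair f g
    exact h.sound_pair (ihf (hf.trans hc)) (ihg (hg.trans hc)) (hrules _ hc)
  | comp f g ihf ihg =>
    obtain ⟨hf, hg⟩ := Code.encode_lt_comp f g
    intro a b hab
    obtain ⟨x, hax, hxb⟩ := hrules _ hc a b hab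
    exact Part.mem_bind_iff.2 ⟨_, ihg (hg.trans hc) a x hax, ihf (hf.trans hc) x b hxb⟩
  | prec f g ihf ihg =>
    obtain ⟨hf, hg⟩ := Code.encode_lt_prec f g
    exact h.sound_prec (ihf (hf.trans hc)) (ihg (hg.trans hc)) (hrules _ hc)
  | rfind' f ihf => exact h.sound_rfind' (ihf ((Code.encode_lt_rfind' f).trans hc)) (hrules _ hc)

end IsSegment

section Evaln

variable {k a b : ℕ} {f g : Code}

theorem mem_evaln_pair (h : b ∈ (Code.pair f g).evaln k a) :
    ∃ x ∈ f.evaln k a, ∃ y ∈ g.evaln k a, Nat.pair x y = b := by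
  cases k with
  | zero => simp [Code.evaln] at h
  | succ k =>
    simp only [Code.evaln, Seq.seq, Option.mem_def, Option.bind_eq_bind, Option.map_eq_map,
      Option.bind_eq_some_iff, Option.map_eq_some_iff] at h
    obtain ⟨-, -, _, ⟨x, hx, rfl⟩, y, hy, hb⟩ := h
    exact ⟨x, hx, y, hy, hb⟩

theorem mem_evaln_comp (h : b ∈ (Code.comp f g).evaln k a) :
    ∃ x ∈ g.evaln k a, b ∈ f.evaln k x := by
  cases k with
  | zero => simp [Code.evaln] at h
  | succ k =>
    simp only [Code.evaln, Option.mem_def, Option.bind_eq_bind, Option.bind_eq_some_iff] at h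
    obtain ⟨-, -, x, hx, hb⟩ := h
    exact ⟨x, hx, hb⟩

theorem mem_evaln_prec (h : b ∈ (Code.prec f g).evaln k a) :
    (a.unpair.2 = 0 ∧ b ∈ f.evaln k a.unpair.1) ∨
      ∃ z i, a.unpair.2 = z + 1 ∧ i ∈ (Code.prec f g).evaln k (Nat.pair a.unpair.1 z) ∧
        b ∈ g.evaln k (Nat.pair a.unpair.1 (Nat.pair z i)) := by
  cases k with
  | zero => simp [Code.evaln] at h
  | succ k =>
    simp only [Code.evaln, Nat.unpaired, Option.mem_def, Option.bind_eq_bind,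
      Option.bind_eq_some_iff] at h
    obtain ⟨-, -, h⟩ := h
    rcases hz : a.unpair.2 with _ | z
    · exact Or.inl ⟨rfl, by rwa [hz] at h⟩
    · rw [hz] at h
      obtain ⟨i, hi, hb⟩ := Option.bind_eq_some_iff.1 h
      exact Or.inr ⟨z, i, rfl, Code.evaln_mono k.le_succ hi, hb⟩

theorem mem_evaln_rfind' (h : b ∈ (Code.rfind' f).evaln k a) :
    ∃ x ∈ f.evaln k a, (x = 0 ∧ b = a.unpair.2) ∨
      ∃ d, x = d + 1 ∧ b ∈ (Code.rfind' f).evaln k (Nat.pair a.unpair.1 (a.unpair.2 + 1)) := by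
  cases k with
  | zero => simp [Code.evaln] at h
  | succ k =>
    simp only [Code.evaln, Nat.unpaired, Nat.pair_unpair, Option.mem_def, Option.bind_eq_bind,
      Option.bind_eq_some_iff] at h
    obtain ⟨-, -, x, hx, h⟩ := h
    refine ⟨x, hx, ?_⟩
    rcases x with _ | d
    · exact Or.inl ⟨rfl, by simpa [eq_comm] using h⟩
    · exact Or.inr ⟨d, rfl, Code.evaln_mono k.le_succ (by simpa using h)⟩

/-- The computations of at most `k` steps with codes below `m` involve numbers below `N` only. -/
def Bounded (k m N : ℕ) : Prop :=
  ∀ c : Code, encode c < m → ∀ a, ∀ b ∈ c.evaln k a, a < N ∧ b < N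

theorem exists_bounded (k m : ℕ) : ∃ N, Bounded k m N := by
  let output (p : ℕ × ℕ) : ℕ := ((Denumerable.ofNat Code p.1).evaln k p.2).getD 0
  let inputs := Finset.range m ×ˢ Finset.range k
  refine ⟨k + inputs.sup output + 1, fun c hc a b hb => ?_⟩
  have ha := Code.evaln_bound hb
  have hle : output (encode c, a) ≤ inputs.sup output := Finset.le_sup (by simp [inputs, hc, ha])
  have heq : output (encode c, a) = b := by simp [output, Option.mem_def.1 hb]
  omega

end Evaln

/-- The numbers below `N` with the standard relations, `graph c` being the computations with code
`c` of at most `k` steps. -/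
def initialSegment (k N : ℕ) : ℕ → Fin N → Fin N → Prop
  | 0, a, b => a < b
  | 1, a, b => (b : ℕ) = a + 1
  | 2, a, _ => (a : ℕ) = 0
  | 3, a, b => (b : ℕ) = (a : ℕ).unpair.1
  | 4, a, b => (b : ℕ) = (a : ℕ).unpair.2
  | r + 5, a, b => (b : ℕ) ∈ (Denumerable.ofNat Code r).evaln k a

section InitialSegment

variable {k m N : ℕ}

theorem initialSegment_graph {c : Code} {a b : Fin N} :
    initialSegment k N (graph c) a b ↔ (b : ℕ) ∈ c.evaln k a := by
  simp [initialSegment]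

theorem isSegment_initialSegment : IsSegment (initialSegment k N) where
  irrefl a := lt_irrefl a
  trans a b c := lt_trans
  total a b := (lt_trichotomy a b).elim (.inr ∘ .inl) (.imp_right .inr)
  succ_spec := by
    simp only [initialSegment, Fin.lt_def]
    rintro a b hab
    exact ⟨by omega, by rintro ⟨c, hac, hcb⟩; omega⟩
  zero_spec := by
    simp only [initialSegment, Fin.lt_def]
    rintro a ha ⟨b, hba⟩
    omega
  left_total n := ⟨⟨_, (Nat.unpair_left_le n).trans_lt n.2⟩, rfl⟩
  right_total n := ⟨⟨_, (Nat.unpair_right_le n).trans_lt n.2⟩, rfl⟩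
  unpair := by
    rintro ⟨_ | n, hn⟩ a b ⟨hl, hr⟩
    · exact Or.inl ⟨rfl, by simpa [initialSegment] using hl, by simpa [initialSegment] using hr⟩
    · have hn' : n < N := (Nat.lt_succ_self n).trans hn
      refine Or.inr ⟨⟨n, hn'⟩, ⟨_, (Nat.unpair_left_le n).trans_lt hn'⟩,
        ⟨_, (Nat.unpair_right_le n).trans_lt hn'⟩, rfl, rfl, rfl, ?_⟩
      simp only [initialSegment, unpair_succ] at hl hr
      simp only [Next, initialSegment, Fin.lt_def, Fin.ext_iff, hl, hr]
      split_ifs <;> simp <;> omega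

theorem exists_unpair_eq (a : Fin N) : ∃ x y : Fin N, (a : ℕ).unpair = (↑x, ↑y) :=
  ⟨⟨_, (Nat.unpair_left_le a).trans_lt a.2⟩, ⟨_, (Nat.unpair_right_le a).trans_lt a.2⟩, rfl⟩

section Rules

variable {f g : Code} (hN : Bounded k m N)
include hN

theorem obeysRule_pair (hc : encode (Code.pair f g) < m) :
    ObeysRule (initialSegment k N) (.pair f g) := by
  intro a b hab
  obtain ⟨hf, hg⟩ := Code.encode_lt_pair f g
  obtain ⟨x, hx, y, hy, hb⟩ := mem_evaln_pair (initialSegment_graph.1 hab)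
  lift x to Fin N using (hN f (hf.trans hc) a x hx).2
  lift y to Fin N using (hN g (hg.trans hc) a y hy).2
  exact ⟨x, y, initialSegment_graph.2 hx, initialSegment_graph.2 hy,
    by simp [initialSegment, ← hb], by simp [initialSegment, ← hb]⟩

theorem obeysRule_comp (hc : encode (Code.comp f g) < m) :
    ObeysRule (initialSegment k N) (.comp f g) := by
  intro a b hab
  obtain ⟨-, hg⟩ := Code.encode_lt_comp f g
  obtain ⟨x, hx, hb⟩ := mem_evaln_comp (initialSegment_graph.1 hab)
  lift x to Fin N using (hN g (hg.trans hc) a x hx).2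
  exact ⟨x, initialSegment_graph.2 hx, initialSegment_graph.2 hb⟩

theorem obeysRule_prec (hc : encode (Code.prec f g) < m) :
    ObeysRule (initialSegment k N) (.prec f g) := by
  intro a b hab
  obtain ⟨-, hg⟩ := Code.encode_lt_prec f g
  have hcases := mem_evaln_prec (initialSegment_graph.1 hab)
  obtain ⟨x, y, hxy⟩ := exists_unpair_eq a
  rw [hxy] at hcases
  refine ⟨x, y, by simp [initialSegment, hxy], by simp [initialSegment, hxy], ?_⟩
  rcases hcases with ⟨hy, hb⟩ | ⟨z, i, hy, hi, hb⟩
  · exact Or.inl ⟨hy, initialSegment_graph.2 hb⟩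
  · have hp := (hN _ hc _ _ hi).1
    have ht := (hN g (hg.trans hc) _ _ hb).1
    have hr := (Nat.right_le_pair _ _).trans_lt ht
    lift i to Fin N using (hN _ hc _ _ hi).2
    lift z to Fin N using (Nat.right_le_pair _ _).trans_lt hp
    exact Or.inr ⟨z, ⟨_, hp⟩, i, ⟨_, hr⟩, ⟨_, ht⟩, hy, by simp [initialSegment],
      by simp [initialSegment], initialSegment_graph.2 hi, by simp [initialSegment],
      by simp [initialSegment], by simp [initialSegment], by simp [initialSegment],
      initialSegment_graph.2 hb⟩

theorem obeysRule_rfind' (hc : encode (Code.rfind' f) < m) :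
    ObeysRule (initialSegment k N) (.rfind' f) := by
  intro a b hab
  obtain ⟨x, hx, hcases⟩ := mem_evaln_rfind' (initialSegment_graph.1 hab)
  obtain ⟨z, y, hzy⟩ := exists_unpair_eq a
  rw [hzy] at hcases
  lift x to Fin N using (hN f ((Code.encode_lt_rfind' f).trans hc) a x hx).2
  refine ⟨x, initialSegment_graph.2 hx, ?_⟩
  rcases hcases with ⟨hx0, hb⟩ | ⟨d, hd, hb⟩
  · exact Or.inl ⟨hx0, by simp [initialSegment, hzy, hb]⟩
  · have hp := (hN _ hc _ _ hb).1
    have hy' := (Nat.right_le_pair _ _).trans_lt hp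
    lift d to Fin N using by omega
    exact Or.inr ⟨d, z, y, ⟨_, hy'⟩, ⟨_, hp⟩, hd, by simp [initialSegment, hzy],
      by simp [initialSegment, hzy], rfl, by simp [initialSegment], by simp [initialSegment],
      initialSegment_graph.2 hb⟩

theorem obeysRule_initialSegment (c : Code) (hc : encode c < m) :
    ObeysRule (initialSegment k N) c := by
  cases c with
  | pair f g => exact obeysRule_pair hN hc
  | comp f g => exact obeysRule_comp hN hc
  | prec f g => exact obeysRule_prec hN hc
  | rfind' f => exact obeysRule_rfind' hN hc
  | zero | succ | left | right =>
    intro a b hab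
    rw [initialSegment_graph] at hab
    obtain ⟨l, rfl⟩ := Nat.exists_eq_succ_of_ne_zero (Nat.ne_zero_of_lt (Code.evaln_bound hab))
    simp only [Code.evaln, Option.mem_def, Option.bind_eq_bind, Option.bind_eq_some_iff,
      Option.pure_def, Option.some.injEq] at hab
    obtain ⟨-, -, hb⟩ := hab
    exact hb.symm

end Rules

end InitialSegment

/-! ### Computations as first-order formulas -/

section Formulas

open Formula

/-- The formula that expresses `Next` for the variables `4, 5, 1, 2`. -/
def next : Formula :=
  ((rel succ 4 1).and <| (rel lt 1 5).and <| same 2 5).or <|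
  ((rel succ 4 5).and <| (same 1 5).and <| rel zero 2 2).or <|
  ((rel lt 5 4).and <| (same 1 4).and <| rel succ 5 2).or <|
  (same 4 5).and <| (rel zero 1 1).and <| rel succ 4 2

/-- The sentence that expresses `IsSegment`. -/
def segment : Formula :=
  (all 0 <| .not (rel lt 0 0)).and <|
  (all 0 <| all 1 <| all 2 <| (rel lt 0 1).imp <| (rel lt 1 2).imp <| rel lt 0 2).and <|
  (all 0 <| all 1 <| (same 0 1).or <| (rel lt 0 1).or <| rel lt 1 0).and <|
  (all 0 <| all 1 <| (rel succ 0 1).imp <|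
    (rel lt 0 1).and <| .not <| ex 2 <| (rel lt 0 2).and <| rel lt 2 1).and <|
  (all 0 <| (rel zero 0 0).imp <| .not <| ex 1 <| rel lt 1 0).and <|
  (all 0 <| ex 1 <| rel left 0 1).and <|
  (all 0 <| ex 1 <| rel right 0 1).and <|
  all 0 <| all 1 <| all 2 <| ((rel left 0 1).and <| rel right 0 2).imp <|
    ((rel zero 0 0).and <| (rel zero 1 1).and <| rel zero 2 2).or <|
      ex 3 <| ex 4 <| ex 5 <|
        (rel succ 3 0).and <| (rel left 3 4).and <| (rel right 3 5).and next

/-- The formula that expresses `Rule` for the variables `0` (argument) and `1` (result). -/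
def rule : Code → Formula
  | .zero => rel zero 1 1
  | .succ => rel succ 0 1
  | .left => rel left 0 1
  | .right => rel right 0 1
  | .pair f g =>
    ex 2 <| ex 3 <|
      (rel (graph f) 0 2).and <| (rel (graph g) 0 3).and <| (rel left 1 2).and <| rel right 1 3
  | .comp f g => ex 2 <| (rel (graph g) 0 2).and <| rel (graph f) 2 1
  | .prec f g =>
    ex 2 <| ex 3 <| (rel left 0 2).and <| (rel right 0 3).and <|
      ((rel zero 3 3).and <| rel (graph f) 2 1).or <|
        ex 4 <| ex 5 <| ex 6 <| ex 7 <| ex 8 <|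
          (rel succ 4 3).and <| (rel left 5 2).and <| (rel right 5 4).and <|
          (rel (graph (.prec f g)) 5 6).and <| (rel left 7 4).and <| (rel right 7 6).and <|
          (rel left 8 2).and <| (rel right 8 7).and <| rel (graph g) 8 1
  | .rfind' f =>
    ex 2 <| (rel (graph f) 0 2).and <|
      ((rel zero 2 2).and <| rel right 0 1).or <|
        ex 3 <| ex 4 <| ex 5 <| ex 6 <| ex 7 <|
          (rel succ 3 2).and <| (rel left 0 4).and <| (rel right 0 5).and <| (rel succ 5 6).and <|
          (rel left 7 4).and <| (rel right 7 6).and <| rel (graph (.rfind' f)) 7 1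

/-- The axioms of a finite segment of arithmetic with the rules for all codes below `m`. -/
def theory : ℕ → Formula
  | 0 => segment
  | m + 1 =>
    (theory m).and <| all 0 <| all 1 <|
      (rel (graph (Denumerable.ofNat Code m)) 0 1).imp <| rule (Denumerable.ofNat Code m)

/-- The function with code `c` has a value at the number that is `n` larger than the variable `0`.
Two variables are enough, as in the step from `n` to `n + 1` the successor is copied from the
variable `1` to the variable `0`. -/
def outputAfter (c : Code) : ℕ → Formula
  | 0 => ex 1 <| rel (graph c) 0 1
  | n + 1 => ex 1 <| (rel succ 0 1).and <| ex 0 <| (same 0 1).and <| outputAfter c n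

/-- Some finite segment of arithmetic contains a computation of the function with code `c` at
`n`. -/
def halting (c : Code) (n : ℕ) : Formula :=
  (theory (encode c + 1)).and <| ex 0 <| (rel zero 0 0).and <| outputAfter c n

section Over

variable {M : ℕ} {c : Code} {V : Set ℕ}

theorem basic_lt (hM : 5 ≤ M) : lt < M ∧ succ < M ∧ zero < M ∧ left < M ∧ right < M :=
  ⟨hM.trans' (by decide), hM.trans' (by decide), hM.trans' (by decide), hM.trans' (by decide),
    hM.trans' (by decide)⟩

theorem rule_over (hc : graph c < M) (h0 : 0 ∈ V) (h1 : 1 ∈ V) : (rule c).Over M V := by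
  have basic := basic_lt ((Nat.le_add_left 5 _).trans hc.le)
  have graph_lt {f : Code} (h : encode f < encode c) : graph f < M :=
    (Nat.add_lt_add_right h 5).trans hc
  cases c with
  | zero | succ | left | right => simp [rule, Over, basic, h0, h1]
  | pair f g =>
    have hlt := Code.encode_lt_pair f g
    simp [rule, Over, basic, h0, h1, graph_lt hlt.1, graph_lt hlt.2]
  | comp f g =>
    have hlt := Code.encode_lt_comp f g
    simp [rule, Over, h0, h1, graph_lt hlt.1, graph_lt hlt.2]
  | prec f g =>
    have hlt := Code.encode_lt_prec f g
    simp [rule, Over, basic, h0, h1, hc, graph_lt hlt.1, graph_lt hlt.2]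
  | rfind' f =>
    simp [rule, Over, basic, h0, h1, hc, graph_lt (Code.encode_lt_rfind' f)]

theorem theory_over {m : ℕ} (hm : m + 5 ≤ M) : (theory m).Over M V := by
  induction m with
  | zero => simp [theory, segment, next, Over, basic_lt hm]
  | succ m ih =>
    have hgraph : graph (Denumerable.ofNat Code m) < M := by
      rw [graph, Denumerable.encode_ofNat]
      omega
    exact ⟨ih (by omega), ⟨hgraph, by simp, by simp⟩, rule_over hgraph (by simp) (by simp)⟩

theorem outputAfter_over (hc : graph c < M) {n : ℕ} (h0 : 0 ∈ V) : (outputAfter c n).Over M V := by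
  have basic := basic_lt ((Nat.le_add_left 5 _).trans hc.le)
  induction n generalizing V with
  | zero => simp [outputAfter, Over, hc, h0]
  | succ n ih =>
    exact ⟨⟨basic.2.1, by simp [h0], by simp⟩, ⟨by simp, by simp⟩, ih (by simp)⟩

theorem halting_over (n : ℕ) : (halting c n).Over (graph c + 1) V :=
  have basic := basic_lt ((Nat.le_add_left 5 (encode c)).trans (Nat.le_succ _))
  ⟨theory_over le_rfl, ⟨basic.2.2.1, by simp, by simp⟩,
    outputAfter_over (Nat.lt_succ_self _) (by simp)⟩

end Over

section Realize

variable {α : Type*} {q : ℕ → α → α → Prop} {v : ℕ → α}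

theorem realize_segment_iff : segment.Realize q v ↔ IsSegment q :=
  ⟨fun ⟨h₁, h₂, h₃, h₄, h₅, h₆, h₇, h₈⟩ => ⟨h₁, h₂, h₃, h₄, h₅, h₆, h₇, h₈⟩,
    fun ⟨h₁, h₂, h₃, h₄, h₅, h₆, h₇, h₈⟩ => ⟨h₁, h₂, h₃, h₄, h₅, h₆, h₇, h₈⟩⟩

theorem realize_rule_iff {c : Code} : (rule c).Realize q v ↔ Rule q c (v 0) (v 1) := by
  cases c <;> exact Iff.rfl

theorem realize_theory_iff {m : ℕ} :
    (theory m).Realize q v ↔ IsSegment q ∧ ∀ c, encode c < m → ObeysRule q c := by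
  induction m with
  | zero => simp [theory, realize_segment_iff]
  | succ m ih =>
    have last : (∀ c, encode c = m → ObeysRule q c) ↔ ObeysRule q (Denumerable.ofNat Code m) :=
      ⟨fun h => h _ (Denumerable.encode_ofNat m), fun h c hc => by rwa [← hc,
        Denumerable.ofNat_encode] at h⟩
    have realize_ruleFor : (all 0 <| all 1 <| (rel (graph (Denumerable.ofNat Code m)) 0 1).imp <|
        rule (Denumerable.ofNat Code m)).Realize q v ↔ ObeysRule q (Denumerable.ofNat Code m) :=
      forall₂_congr fun _ _ => imp_congr Iff.rfl realize_rule_iff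
    simp only [theory, Realize, ih] at realize_ruleFor ⊢
    rw [realize_ruleFor, ← last]
    simp only [Order.lt_add_one_iff, Nat.le_iff_lt_or_eq, or_imp, forall_and, and_assoc]

theorem realize_outputAfter_succ_iff {c : Code} {n : ℕ} :
    (outputAfter c (n + 1)).Realize q v ↔
      ∃ x, q succ (v 0) x ∧
        (outputAfter c n).Realize q (Function.update (Function.update v 1 x) 0 x) := by
  simp [outputAfter, Realize]

theorem IsSegment.exists_graph_of_realize_outputAfter [Finite α] (h : IsSegment q) {c : Code}
    {n : ℕ} (hv : (outputAfter c n).Realize q v) :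
    ∃ a b, value q a = value q (v 0) + n ∧ q (graph c) a b := by
  induction n generalizing v with
  | zero =>
    obtain ⟨b, hb⟩ := hv
    exact ⟨v 0, b, rfl, hb⟩
  | succ n ih =>
    obtain ⟨x, hx, hn⟩ := realize_outputAfter_succ_iff.1 hv
    obtain ⟨a, b, ha, hab⟩ := ih hn
    refine ⟨a, b, ?_, hab⟩
    rw [ha, Function.update_self, h.value_succ hx]
    omega

theorem realize_outputAfter_initialSegment {k N : ℕ} {c : Code} {n : ℕ} {v : ℕ → Fin N}
    {a b : Fin N} (ha : (a : ℕ) = v 0 + n) (hab : (b : ℕ) ∈ c.evaln k a) :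
    (outputAfter c n).Realize (initialSegment k N) v := by
  induction n generalizing v with
  | zero =>
    obtain rfl : a = v 0 := Fin.ext ha
    exact ⟨b, initialSegment_graph.2 hab⟩
  | succ n ih =>
    refine realize_outputAfter_succ_iff.2 ⟨⟨v 0 + 1, by omega⟩, rfl, ih ?_⟩
    simp only [Function.update_self]
    omega

end Realize

theorem dom_of_hasFiniteModel_halting {c : Code} {n : ℕ} (h : (halting c n).HasFiniteModel) :
    (c.eval n).Dom := by
  obtain ⟨N, q, v, htheory, o, ho, hout⟩ := h
  obtain ⟨hseg, hrules⟩ := realize_theory_iff.1 htheory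
  obtain ⟨a, b, ha, hab⟩ := hseg.exists_graph_of_realize_outputAfter hout
  have hn : value q a = n := by rw [ha, hseg.value_zero ho, Nat.zero_add]
  exact Part.dom_iff_mem.2 ⟨_, hn ▸ hseg.sound hrules c (Nat.lt_succ_self _) a b hab⟩

theorem hasFiniteModel_halting_of_dom {c : Code} {n : ℕ} (h : (c.eval n).Dom) :
    (halting c n).HasFiniteModel := by
  obtain ⟨b, hb⟩ := Part.dom_iff_mem.1 h
  obtain ⟨k, hk⟩ := Code.evaln_complete.1 hb
  obtain ⟨N, hN⟩ := exists_bounded k (encode c + 1)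
  obtain ⟨hnN, hbN⟩ := hN c (Nat.lt_succ_self _) n b hk
  let o : Fin N := ⟨0, by omega⟩
  refine ⟨N, initialSegment k N, fun _ => o, ?_, o, rfl, ?_⟩
  · exact realize_theory_iff.2 ⟨isSegment_initialSegment, obeysRule_initialSegment hN⟩
  · exact realize_outputAfter_initialSegment (a := ⟨n, hnN⟩) (b := ⟨b, hbN⟩) (by simp [o]) hk

theorem hasFiniteModel_halting_iff {c : Code} {n : ℕ} :
    (halting c n).HasFiniteModel ↔ (c.eval n).Dom :=
  ⟨dom_of_hasFiniteModel_halting, hasFiniteModel_halting_of_dom⟩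

end Formulas

end Arith

/-! ### Artifact termination in terms of reachable states -/

section Termination

variable {B : Model} {fr : FrameRule} {C C' : Config}

theorem mem_reachesTerm_of_term {A T x : ℕ} (h : Fact.inst T x ∈ C.snap) :
    C ∈ reachesTerm B fr A T x := by
  rw [reachesTerm, ← OrderHom.map_lfp]
  exact Or.inl h

theorem mem_reachesTerm_of_step {A T x : ℕ} (h : Fact.inst A x ∈ C.snap) (hC : Step B fr C C')
    (hC' : C' ∈ reachesTerm B fr A T x) : C ∈ reachesTerm B fr A T x := by
  rw [reachesTerm, ← OrderHom.map_lfp]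
  exact Or.inr ⟨h, C', hC, hC'⟩

theorem exists_reachable_of_mem_reachesTerm {A T x : ℕ} (h : C ∈ reachesTerm B fr A T x) :
    ∃ C', Relation.ReflTransGen (Step B fr) C C' ∧ Fact.inst T x ∈ C'.snap := by
  refine OrderHom.lfp_le _ (a := {C | ∃ C', Relation.ReflTransGen (Step B fr) C C' ∧
    Fact.inst T x ∈ C'.snap}) ?_ h
  rintro C (h | ⟨-, C', hC, C'', hC', h⟩)
  · exact ⟨C, .refl, h⟩
  · exact ⟨C'', .head hC hC', h⟩

theorem mem_terminationProperty_of_reachable (hC : C ∈ terminationProperty B fr)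
    (h : Relation.ReflTransGen (Step B fr) C C') : C' ∈ terminationProperty B fr := by
  induction h with
  | refl => exact hC
  | tail _ hstep ih =>
    rw [terminationProperty, ← OrderHom.map_gfp] at ih
    exact ih.2 _ hstep

theorem Model.Terminates.mem_reachesTerm (h : B.Terminates fr)
    (hC : Relation.ReflTransGen (Step B fr) initialConfig C) {S : Chart} (hS : S ∈ B.charts)
    {x : ℕ} (hx : Fact.inst S.artifact x ∈ C.snap) : C ∈ reachesTerm B fr S.artifact S.term x := by
  have hterm := mem_terminationProperty_of_reachable h hC
  rw [terminationProperty, ← OrderHom.map_gfp] at hterm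
  exact hterm.1 S hS x hx

theorem terminates_of_forall_mem_reachesTerm (h : ∀ C : Config, ∀ S ∈ B.charts, ∀ x,
    Fact.inst S.artifact x ∈ C.snap → C ∈ reachesTerm B fr S.artifact S.term x) :
    B.Terminates fr :=
  OrderHom.le_gfp _ (a := Set.univ) (fun C _ => ⟨h C, fun _ _ => trivial⟩) trivial

theorem Contract.Post.exists_effect {A : ℕ} {K : Contract} {self result : Option ℕ}
    {args : List Val} {s s₀ : Snapshot} (h : K.Post B A self result args s s₀) :
    ∃ s', K.Effect B fr A self result args s s' := by
  obtain ⟨s', hs', hmin⟩ := exists_minimalFor_of_wellFoundedLT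
    (fun s' => K.Post B A self result args s s') (fun s' => symmDiff s s') ⟨s₀, h⟩
  refine ⟨s', hs', fun _ s'' hs'' hle => ?_⟩
  exact symmDiff_right_injective s (le_antisymm hle (hmin hs'' hle))

theorem Step.holds_constraint (h : Step B fr C C') {φ : Cond} (hφ : φ ∈ B.constraints)
    (hC : Cond.Holds B.diagram C.snap φ emptyEnv) :
    Cond.Holds B.diagram C'.snap φ emptyEnv := by
  cases h with
  | task _ hK =>
    obtain ⟨-, args, -, -, ⟨-, -, hK, -⟩ | ⟨-, -, r, -, -, hK, -⟩⟩ := hK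
    · exact hK.2.1 φ hφ
    · exact hK.2.1 φ hφ
  | _ => exact hC

theorem Model.WellFormed.holds_constraint (hB : B.WellFormed)
    (hC : Relation.ReflTransGen (Step B fr) initialConfig C) {φ : Cond} (hφ : φ ∈ B.constraints) :
    Cond.Holds B.diagram C.snap φ emptyEnv := by
  induction hC with
  | refl => exact hB.constraints_empty φ hφ
  | tail _ hstep ih => exact hstep.holds_constraint hφ ih

theorem Config.exists_fresh (C : Config) :
    ∃ r, ¬ C.snap.Live r ∧ ∀ p ∈ C.runs, p.self ≠ some r := by
  have hlive : {r | C.snap.Live r}.Finite := by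
    let object : Fact → ℕ := fun | .inst _ o => o | .attr _ o _ => o | .link _ o _ => o
    refine (C.snap.finite_toSet.image object).subset ?_
    rintro r ⟨c, hc⟩
    exact ⟨_, hc, rfl⟩
  have hself : {r | ∃ p ∈ C.runs, p.self = some r}.Finite := by
    refine (C.runs.map Run.self).finite_toSet.preimage (Option.some_injective ℕ).injOn |>.subset ?_
    rintro r ⟨p, hp, hr⟩
    exact Multiset.mem_map.2 ⟨p, hp, hr⟩
  obtain ⟨r, hr⟩ := (hlive.union hself).infinite_compl.nonempty
  exact ⟨r, fun h => hr (Or.inl h), fun p hp h => hr (Or.inr ⟨p, hp, h⟩)⟩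

end Termination

/-! ### The model of a formula -/

namespace Reduction

/-- Class `0` is the artifact, with initial state `1` and termination state `2`; the objects of
class `3` are the elements of a finite structure with `M` binary relations. -/
def diagram (M : ℕ) : ClassDiagram where
  numClasses := 4
  isa := [(1, 0), (2, 0)]
  attrs := []
  assocs := List.replicate M ⟨3, 3, ⟨0, none⟩, ⟨0, none⟩⟩

/-- There are no artifact instances in the termination state, unless the elements of class `3` form
a model of `φ`. The outer quantifier excludes the empty structure. -/
def modelConstraint (φ : Formula) : Cond :=
  .not (.and (.not (.isEmpty (.allInstances 2 false))) (.not ((Formula.ex 0 φ).toOCL 3)))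

/-- An artifact instance is created in its initial state; the other instances persist. -/
def createTask : Contract where
  params := []
  creates := true
  pre := .tt
  post := .and (.isTypeOf (.var .result) 1)
    (.includesAll (.allInstances 0 false) (.allInstances 0 true))

/-- All artifact instances pass to the termination state. -/
def closeTask : Contract where
  params := []
  creates := false
  pre := .tt
  post := .includesAll (.allInstances 2 false) (.allInstances 0 true)

/-- The activity diagram with the single task `K`. -/
def taskActivity (K : Contract) : Activity := [.initial 0, .task 0 1 K, .final 1]

/-- The state transition diagram that creates an artifact instance and then closes it. -/
def chart : Chart where
  artifact := 0
  init := 1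
  term := 2
  initTrans := [(0, .tt)]
  trans := [(1, 1, .tt, 2)]
  activities := [taskActivity createTask, taskActivity closeTask]

/-- The BAUML model in which the artifact can terminate if and only if `φ` has a finite model. -/
def model (M : ℕ) (φ : Formula) : Model where
  diagram := diagram M
  constraints := [modelConstraint φ]
  charts := [chart]

section WellFormed

variable {M : ℕ}

theorem isA_diagram_iff {c d : ℕ} : (diagram M).IsA c d ↔ c = d ∨ (d = 0 ∧ (c = 1 ∨ c = 2)) := by
  constructor
  · intro h
    induction h with
    | refl => exact Or.inl rfl
    | tail _ h ih =>
      simp only [diagram, List.mem_cons, Prod.mk.injEq, List.not_mem_nil, or_false] at h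
      omega
  · rintro (rfl | ⟨rfl, rfl | rfl⟩)
    · exact .refl
    · exact .single (by simp [diagram])
    · exact .single (by simp [diagram])

theorem isLeaf_diagram_iff {c : ℕ} : (diagram M).IsLeaf 0 c ↔ c = 1 ∨ c = 2 := by
  rw [ClassDiagram.IsLeaf, isA_diagram_iff]
  constructor
  · rintro ⟨rfl | ⟨-, h⟩, hl⟩
    · exact (hl 1 (by simp [diagram])).elim
    · exact h
  · rintro (rfl | rfl) <;> simp [diagram]

theorem diagram_wellFormed : (diagram M).WellFormed where
  isa_lt := by simp [diagram]
  isa_acyclic := by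
    have lt_of_transGen {c d : ℕ}
        (h : Relation.TransGen (fun c d => (c, d) ∈ (diagram M).isa) c d) : d < c :=
      h.trans_induction_on
        (fun h => by
          simp only [diagram, List.mem_cons, Prod.mk.injEq, List.not_mem_nil, or_false] at h
          omega)
        fun _ _ h h' => h'.trans h
    exact fun c hc => lt_irrefl c (lt_of_transGen hc)
  attr_lt := by simp [diagram]
  assoc_lt := by simp [diagram]
  mult_le := by simp [diagram]

theorem taskActivity_wellFormed {D : ClassDiagram} {A : ℕ} {K : Contract}
    (hK : K.WellFormed D A) : Activity.WellFormed D A (taskActivity K) where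
  node := by simp [taskActivity, Node.WellFormed, hK]
  initial := by
    refine ⟨0, ⟨0, rfl⟩, ?_⟩
    rintro (_ | _ | _ | i) ⟨o, h⟩ <;> simp [taskActivity] at h ⊢
  outs_nodup := by simp [taskActivity, Node.outs]
  ins_nodup := by simp [taskActivity, Node.ins]
  connected := by simp [taskActivity, Node.outs, Node.ins]

theorem createTask_wellFormed : createTask.WellFormed (diagram M) 0 where
  params_lt := by simp [createTask]
  pre_typed := rfl
  post_typed := ⟨rfl, ⟨rfl, by simp [diagram], 0, ⟨.cls 0, rfl, .refl⟩,
      isA_diagram_iff.2 (by simp)⟩,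
    rfl, .cls 0, ⟨by simp, by simp [diagram], .refl⟩, ⟨by simp, by simp [diagram], .refl⟩⟩

theorem closeTask_wellFormed : closeTask.WellFormed (diagram M) 0 where
  params_lt := by simp [closeTask]
  pre_typed := rfl
  post_typed := ⟨rfl, .cls 0, ⟨by simp, by simp [diagram], isA_diagram_iff.2 (by simp)⟩,
    ⟨by simp, by simp [diagram], .refl⟩⟩

theorem chart_wellFormed : chart.WellFormed (diagram M) where
  artifact_lt := by simp [chart, diagram]
  artifact_top := by simp [chart, diagram]
  init_leaf := isLeaf_diagram_iff.2 (Or.inl rfl)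
  term_leaf := isLeaf_diagram_iff.2 (Or.inr rfl)
  initTrans := List.forall_mem_singleton.2 ⟨Nat.zero_lt_two, rfl⟩
  trans := List.forall_mem_singleton.2
    ⟨isLeaf_diagram_iff.2 (Or.inl rfl), Nat.one_lt_two, rfl, isLeaf_diagram_iff.2 (Or.inr rfl)⟩
  activity := List.forall_mem_cons.2 ⟨taskActivity_wellFormed createTask_wellFormed,
    List.forall_mem_singleton.2 (taskActivity_wellFormed closeTask_wellFormed)⟩
  creates := by
    refine List.forall_mem_singleton.2 fun P hP i o K hK => ?_
    obtain rfl : taskActivity closeTask = P := Option.some.inj hP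
    obtain ⟨-, -, rfl⟩ : i = 0 ∧ o = 1 ∧ K = closeTask := by simpa [taskActivity] using hK
    rfl

theorem model_wellFormed {φ : Formula} (hφ : (Formula.ex 0 φ).Over M ∅) :
    (model M φ).WellFormed where
  diagram := diagram_wellFormed
  constraints := by
    have hassoc : ∀ r < M, ∃ d, (diagram M).assocs[r]? = some d ∧ d.dom = 3 ∧ d.img = 3 :=
      fun r hr => ⟨⟨3, 3, ⟨0, none⟩, ⟨0, none⟩⟩, by simp [diagram, hr], rfl, rfl⟩
    refine List.forall_mem_singleton.2 ⟨rfl, rfl, ⟨rfl, rfl, .cls 2, by simp, ?_, .refl⟩, rfl, ?_⟩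
    · exact show 2 < 4 by decide
    · exact Formula.hasTy_toOCL (show 3 < 4 by decide) hassoc hφ (by simp)
  constraints_empty := List.forall_mem_singleton.2 <| by
    simp [modelConstraint, Cond.Holds, Expr.eval]
  charts := List.forall_mem_singleton.2 chart_wellFormed
  arts_nodup := by simp [Model.arts, model]
  arts_disjoint := by simp [Model.arts, model]

end WellFormed

section InformationBase

variable {opened closed : Finset ℕ} {M N : ℕ} {q : ℕ → Fin N → Fin N → Prop}

open Classical in
/-- The information base with the given artifact instances in the initial state and in the
termination state, and with a copy of the structure with carrier `Fin N` and relations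
`q 0, …, q (M - 1)`. -/
noncomputable def base (opened closed : Finset ℕ) (M : ℕ) (q : ℕ → Fin N → Fin N → Prop) :
    Snapshot :=
  (opened ∪ closed).image (Fact.inst 0) ∪ opened.image (Fact.inst 1) ∪
  closed.image (Fact.inst 2) ∪ (Finset.range N).image (Fact.inst 3) ∪
  ({p | q p.1 p.2.1 p.2.2} : Finset (Fin M × Fin N × Fin N)).image fun p =>
    Fact.link p.1 p.2.1 p.2.2

theorem inst_mem_base_iff {c o : ℕ} : Fact.inst c o ∈ base opened closed M q ↔
    (c = 0 ∧ (o ∈ opened ∨ o ∈ closed)) ∨ (c = 1 ∧ o ∈ opened) ∨ (c = 2 ∧ o ∈ closed) ∨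
      (c = 3 ∧ o < N) := by
  simp only [base, Finset.mem_union, Finset.mem_image, Fact.inst.injEq, Finset.mem_range,
    reduceCtorEq, and_false, exists_false, or_false, or_assoc]
  grind

theorem attr_notMem_base {a o v : ℕ} : Fact.attr a o v ∉ base opened closed M q := by
  simp [base]

theorem link_mem_base_iff {r o o' : ℕ} : Fact.link r o o' ∈ base opened closed M q ↔
    r < M ∧ ∃ a b : Fin N, a = o ∧ b = o' ∧ q r a b := by
  simp only [base, Finset.mem_union, Finset.mem_image, reduceCtorEq, and_false, exists_false,
    false_or, Finset.mem_filter_univ, Prod.exists, Fact.link.injEq]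
  constructor
  · rintro ⟨r, a, b, hq, rfl, rfl, rfl⟩
    exact ⟨r.isLt, a, b, rfl, rfl, hq⟩
  · rintro ⟨hr, a, b, rfl, rfl, hq⟩
    exact ⟨⟨r, hr⟩, a, b, hq, rfl, rfl, rfl⟩

theorem base_represents : (base opened closed M q).Represents 3 M q Fin.val where
  injective := Fin.val_injective
  inst_iff o := by simp [inst_mem_base_iff]
  link_iff r hr a b := by simp [link_mem_base_iff, hr, Fin.val_inj]

theorem base_legal (h : Disjoint opened closed) :
    (base opened closed M q).Legal (diagram M) [0] where
  class_lt c o ho := by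
    rw [inst_mem_base_iff] at ho
    simp only [diagram]
    omega
  isa c d o hcd ho := by
    rw [inst_mem_base_iff] at ho ⊢
    simp only [diagram, List.mem_cons, Prod.mk.injEq, List.not_mem_nil, or_false] at hcd
    grind
  attr_typed := fun _ _ _ h => (attr_notMem_base h).elim
  attr_value := by simp [diagram]
  link_typed r o o' hl := by
    obtain ⟨hr, a, b, rfl, rfl, -⟩ := link_mem_base_iff.1 hl
    exact ⟨⟨3, 3, ⟨0, none⟩, ⟨0, none⟩⟩, by simp [diagram, hr],
      inst_mem_base_iff.2 (by simp), inst_mem_base_iff.2 (by simp)⟩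
  img_mult r d hd o _ := by
    obtain rfl := List.eq_of_mem_replicate (List.mem_of_getElem? hd)
    simp [Mult.Allows]
  dom_mult r d hd o _ := by
    obtain rfl := List.eq_of_mem_replicate (List.mem_of_getElem? hd)
    simp [Mult.Allows]
  state := List.forall_mem_singleton.2 fun o ho => by
    have ho' : o ∈ opened ∨ o ∈ closed := by simpa [inst_mem_base_iff] using ho
    have hdisj := Finset.disjoint_left.1 h
    simp only [isLeaf_diagram_iff, inst_mem_base_iff]
    rcases ho' with hopened | hclosed
    · exact ⟨1, by simp [hopened], by rintro c ⟨rfl | rfl, hc⟩ <;> simp_all⟩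
    · exact ⟨2, by simp [hclosed], by rintro c ⟨rfl | rfl, hc⟩ <;> simp_all⟩

end InformationBase

section Execution

variable {M : ℕ} {φ : Formula} {fr : FrameRule}

theorem holds_modelConstraint_iff {D : ClassDiagram} {s : Snapshot} {ρ : Env} :
    Cond.Holds D s (modelConstraint φ) ρ ↔
      ∀ o, Fact.inst 2 o ∈ s → Cond.Holds D s ((Formula.ex 0 φ).toOCL 3) ρ := by
  refine not_and_not_right.trans (Iff.trans (imp_congr_left ?_) forall_exists_index)
  simp only [Expr.eval, cond_false, Set.eq_empty_iff_forall_notMem, Set.mem_ofPred_eq, not_forall,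
    not_not]
  exact ⟨fun ⟨_, o, _, ho⟩ => ⟨o, ho⟩, fun ⟨o, ho⟩ => ⟨_, o, rfl, ho⟩⟩

theorem hasFiniteModel_of_holds (hφ : (Formula.ex 0 φ).Over M ∅) {D : ClassDiagram} {s : Snapshot}
    {ρ : Env} (h : Cond.Holds D s ((Formula.ex 0 φ).toOCL 3) ρ) : φ.HasFiniteModel := by
  obtain ⟨N, q, e, hs⟩ := s.exists_represents 3 M
  obtain ⟨a, ha⟩ := hs.holds_ex_iff.1 h
  exact ⟨N, q, fun _ => a, (Formula.holds_toOCL_iff hs (V := insert 0 ∅) hφ (by simp)).1 ha⟩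

theorem allInstances_subset_iff {D : ClassDiagram} {s s' : Snapshot} {ρ : Env} {c d : ℕ} :
    (Expr.eval D s s' (.allInstances c true) ρ : Set Val) ⊆
      (Expr.eval D s s' (.allInstances d false) ρ : Set Val) ↔
      ∀ o, Fact.inst c o ∈ s → Fact.inst d o ∈ s' := by
  constructor
  · intro h o ho
    obtain ⟨_, e, ho'⟩ := h ⟨o, rfl, ho⟩
    cases e
    exact ho'
  · rintro h _ ⟨o, rfl, ho⟩
    exact ⟨o, rfl, h o ho⟩

theorem holdsPost_createTask_iff {s s' : Snapshot} {r : ℕ} :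
    Cond.HoldsPost (diagram M) s s' createTask.post (taskEnv none (some r) []) ↔
      Fact.inst 1 r ∈ s' ∧ ∀ o, Fact.inst 0 o ∈ s → Fact.inst 0 o ∈ s' := by
  have no_subclass (d : ℕ) : (d, 1) ∉ (diagram M).isa := by simp [diagram]
  refine and_congr ?_ allInstances_subset_iff
  simp [Expr.eval, taskEnv, no_subclass]

theorem exists_artifacts (s : Snapshot) : ∃ X : Finset ℕ, ∀ o, o ∈ X ↔ Fact.inst 0 o ∈ s :=
  have hinj : Function.Injective (Fact.inst 0) := fun _ _ h => (Fact.inst.inj h).2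
  ⟨s.preimage (Fact.inst 0) hinj.injOn, by simp⟩

theorem exists_exec_createTask (s : Snapshot) {r : ℕ} (hr : ¬ s.Live r) :
    ∃ s', createTask.Exec (model M φ) fr 0 none (some r) s s' ∧ Fact.inst 0 r ∈ s' ∧
      Fact.inst 1 r ∈ s' ∧ ∀ o, Fact.inst 0 o ∈ s → Fact.inst 0 o ∈ s' := by
  obtain ⟨X, hX⟩ := exists_artifacts s
  have hpost : createTask.Post (model M φ) 0 none (some r) [] s
      (base (N := 0) (insert r X) ∅ M fun _ _ _ => False) := by
    refine ⟨base_legal (Finset.disjoint_empty_right _), List.forall_mem_singleton.2 ?_, ?_,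
      holdsPost_createTask_iff.2 ⟨?_, fun o ho => ?_⟩⟩
    · exact holds_modelConstraint_iff.2 fun o ho => by simp [inst_mem_base_iff] at ho
    · simp [inst_mem_base_iff]
    · simp [inst_mem_base_iff]
    · simp [inst_mem_base_iff, hX, ho]
  obtain ⟨s', h⟩ := hpost.exists_effect (fr := fr)
  obtain ⟨hopened, hpersist⟩ := holdsPost_createTask_iff.1 h.1.2.2.2
  exact ⟨s', ⟨by simp, [], .nil, trivial, Or.inr ⟨rfl, rfl, r, hr, rfl, h⟩⟩,
    h.1.2.2.1 r rfl, hopened, hpersist⟩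

theorem exists_exec_closeTask (hφ : (Formula.ex 0 φ).Over M ∅) (hmodel : φ.HasFiniteModel)
    (s : Snapshot) {r : ℕ} (hr : Fact.inst 0 r ∈ s) :
    ∃ s', closeTask.Exec (model M φ) fr 0 (some r) (some r) s s' ∧
      ∀ o, Fact.inst 0 o ∈ s → Fact.inst 2 o ∈ s' := by
  obtain ⟨X, hX⟩ := exists_artifacts s
  obtain ⟨N, q, v, hv⟩ := hmodel
  have hex : (Formula.ex 0 φ).Realize q v := ⟨v 0, by rwa [Function.update_eq_self]⟩
  have hpost : closeTask.Post (model M φ) 0 (some r) none [] s (base ∅ X M q) := by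
    refine ⟨base_legal (Finset.disjoint_empty_left _), List.forall_mem_singleton.2 ?_, by simp,
      allInstances_subset_iff.2 fun o ho => ?_⟩
    · exact holds_modelConstraint_iff.2 fun _ _ =>
        (Formula.holds_toOCL_iff base_represents hφ (by simp)).2 hex
    · simp [inst_mem_base_iff, hX, ho]
  obtain ⟨s', h⟩ := hpost.exists_effect (fr := fr)
  exact ⟨s', ⟨by simpa using hr, [], .nil, trivial, Or.inl ⟨rfl, rfl, h⟩⟩,
    allInstances_subset_iff.1 h.1.2.2.2⟩

theorem step_launch (s : Snapshot) (R : Multiset Run) :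
    Step (model M φ) fr ⟨s, R⟩ ⟨s, ⟨0, taskActivity createTask, 1, none, {0}⟩ ::ₘ R⟩ :=
  Step.launch (S := chart) (ε := 0) (φ := .tt) (by simp [model]) (by simp [chart]) rfl trivial
    (by simp [taskActivity])

theorem step_start {s : Snapshot} {R : Multiset Run} {o : ℕ} (hartifact : Fact.inst 0 o ∈ s)
    (hopened : Fact.inst 1 o ∈ s) (hR : ∀ p ∈ R, p.self ≠ some o) :
    Step (model M φ) fr ⟨s, R⟩ ⟨s, ⟨0, taskActivity closeTask, 2, some o, {0}⟩ ::ₘ R⟩ :=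
  Step.start (S := chart) (v := 1) (ε := 1) (φ := .tt) (by simp [model]) (by simp [chart]) rfl
    hartifact hopened hR trivial (by simp [taskActivity])

theorem step_task {B : Model} {s s' : Snapshot} {R : Multiset Run} {K : Contract} {A t : ℕ}
    {self self' : Option ℕ} (h : K.Exec B fr A self self' s s')
    (hR : ∀ r ∈ self', ∀ p ∈ R, p.self ≠ some r) :
    Step B fr ⟨s, ⟨A, taskActivity K, t, self, {0}⟩ ::ₘ R⟩
      ⟨s', ⟨A, taskActivity K, t, self', {1}⟩ ::ₘ R⟩ :=
  Step.task (i := 0) (o := 1) (m := 0) (by simp [taskActivity]) h hR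

theorem step_finish {B : Model} {s : Snapshot} {R : Multiset Run} {K : Contract} {A t o : ℕ}
    (h : Fact.inst t o ∈ s) :
    Step B fr ⟨s, ⟨A, taskActivity K, t, some o, {1}⟩ ::ₘ R⟩ ⟨s, R⟩ :=
  Step.finish (i := 1) (m := 0) (by simp [taskActivity]) h

/-- A new artifact instance is created and then closed, which closes `x` as well. This also works
if `x` itself is blocked by an activity that cannot end. -/
theorem mem_reachesTerm (hφ : (Formula.ex 0 φ).Over M ∅) (hmodel : φ.HasFiniteModel) (C : Config)
    {x : ℕ} (hx : Fact.inst 0 x ∈ C.snap) : C ∈ reachesTerm (model M φ) fr 0 2 x := by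
  obtain ⟨y, hy, hyR⟩ := C.exists_fresh
  obtain ⟨s, R⟩ := C
  obtain ⟨s₁, hcreate, hartifact, hopened, hpersist⟩ :=
    exists_exec_createTask (M := M) (φ := φ) (fr := fr) s hy
  obtain ⟨s₂, hclose, hclosed⟩ := exists_exec_closeTask (fr := fr) hφ hmodel s₁ hartifact
  have hR : ∀ r ∈ some y, ∀ p ∈ R, p.self ≠ some r := by simpa using hyR
  have hx₁ := hpersist x hx
  exact mem_reachesTerm_of_step hx (step_launch s R) <|
    mem_reachesTerm_of_step hx (step_task hcreate hR) <|
    mem_reachesTerm_of_step hx₁ (step_finish hopened) <|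
    mem_reachesTerm_of_step hx₁ (step_start hartifact hopened hyR) <|
    mem_reachesTerm_of_step hx₁ (step_task hclose hR) <|
    mem_reachesTerm_of_term (hclosed x hx₁)

theorem hasFiniteModel_of_terminates (hφ : (Formula.ex 0 φ).Over M ∅)
    (h : (model M φ).Terminates fr) : φ.HasFiniteModel := by
  obtain ⟨s, hcreate, hartifact, -⟩ :=
    exists_exec_createTask (M := M) (φ := φ) (fr := fr) ∅ (r := 0) (by simp [Snapshot.Live])
  have hreach := (Relation.ReflTransGen.single (step_launch (M := M) (φ := φ) (fr := fr) ∅ 0)).tail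
    (step_task hcreate (by simp))
  obtain ⟨C, hC, hclosed⟩ := exists_reachable_of_mem_reachesTerm
    (h.mem_reachesTerm hreach (List.mem_singleton_self chart) hartifact)
  have hconstraint := (model_wellFormed hφ).holds_constraint (hreach.trans hC)
    (List.mem_singleton_self (modelConstraint φ))
  exact hasFiniteModel_of_holds hφ (holds_modelConstraint_iff.1 hconstraint 0 hclosed)

theorem model_terminates_iff (hφ : (Formula.ex 0 φ).Over M ∅) :
    (model M φ).Terminates fr ↔ φ.HasFiniteModel := by
  refine ⟨hasFiniteModel_of_terminates hφ, fun hmodel => ?_⟩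
  refine terminates_of_forall_mem_reachesTerm fun C S hS x hx => ?_
  obtain rfl : S = chart := List.mem_singleton.1 hS
  exact mem_reachesTerm hφ hmodel C hx

end Execution

end Reduction

/-! ### Computability of the reduction -/

theorem primrec_code_and (φ : Cond) :
    Primrec fun m : ℕ => Nat.pair 13 (encode (φ.code, m)) :=
  Primrec₂.natPair.comp (.const 13) (Primrec.encode.comp ((Primrec.const _).pair .id))

theorem primrec_code_ex (e : Expr .coll) (x : ℕ) :
    Primrec fun m : ℕ => Nat.pair 17 (encode (e.code, x, m)) :=
  Primrec₂.natPair.comp (.const 17)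
    (Primrec.encode.comp ((Primrec.const _).pair ((Primrec.const _).pair .id)))

theorem primrec_code_not : Primrec fun m => Nat.pair 12 m :=
  Primrec₂.natPair.comp (.const 12) .id

theorem Arith.primrec_code_outputAfter (c : Code) (u : ℕ) :
    Primrec fun n => ((outputAfter c n).toOCL u).code := by
  have code_succ := (primrec_code_ex (.allInstances u false) 1).comp <|
    (primrec_code_and ((Formula.rel succ 0 1).toOCL u)).comp <|
    (primrec_code_ex (.allInstances u false) 0).comp <|
    primrec_code_and ((Formula.same 0 1).toOCL u)
  refine (Primrec.nat_rec₁ ((outputAfter c 0).toOCL u).code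
    (code_succ.comp Primrec.snd).to₂).of_eq fun n => ?_
  induction n with
  | zero => rfl
  | succ n ih => simp only [ih]; rfl

theorem Arith.primrec_code_halting (c : Code) (u : ℕ) :
    Primrec fun n => ((halting c n).toOCL u).code :=
  (primrec_code_and ((theory (encode c + 1)).toOCL u)).comp <|
    (primrec_code_ex (.allInstances u false) 0).comp <|
    (primrec_code_and ((Formula.rel zero 0 0).toOCL u)).comp (primrec_code_outputAfter c u)

theorem Reduction.primrec_code_model {φ : ℕ → Formula} (M : ℕ)
    (hφ : Primrec fun n => ((φ n).toOCL 3).code) : Primrec fun n => (model M (φ n)).code := by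
  have hconstraint : Primrec fun n => (modelConstraint (φ n)).code :=
    primrec_code_not.comp <| (primrec_code_and (.not (.isEmpty (.allInstances 2 false)))).comp <|
      primrec_code_not.comp <| (primrec_code_ex (.allInstances 3 false) 0).comp hφ
  exact Primrec.encode.comp <| (Primrec.const (diagram M).code).pair <|
    (Primrec.list_cons.comp hconstraint (.const [])).pair (.const [chart.code])

/-- The witness maps (the number of) a code to the value of its function at `0`. -/
theorem exists_code_dom_undecidable :
    ∃ c : Code, ¬ ComputablePred fun n => (c.eval n).Dom := by
  have huniv : Partrec fun n : ℕ => (Denumerable.ofNat Code n).eval 0 :=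
    Code.eval_part.comp (Computable.ofNat Code) (Computable.const 0)
  obtain ⟨c, hc⟩ := Code.exists_code.1 (Partrec.nat_iff.1 huniv)
  refine ⟨c, fun hdec => ComputablePred.halting_problem 0 ?_⟩
  exact ComputablePred.computable_of_manyOneReducible
    ⟨encode, Computable.encode, fun d => by simp [hc]⟩ hdec

end BAUML

theorem mainTheorem3 (fr : BAUML.FrameRule) :
    ¬ ∃ f : ℕ → Bool, Computable f ∧
      ∀ B : BAUML.Model, B.WellFormed → (f B.code = true ↔ B.Terminates fr) := by
  rintro ⟨f, hf, hdecides⟩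
  obtain ⟨c, hc⟩ := BAUML.exists_code_dom_undecidable
  let B (n : ℕ) := BAUML.Reduction.model (BAUML.Arith.graph c + 1) (BAUML.Arith.halting c n)
  have hB (n : ℕ) : f (B n).code = true ↔ (c.eval n).Dom := by
    rw [hdecides _ (BAUML.Reduction.model_wellFormed (BAUML.Arith.halting_over n)),
      BAUML.Reduction.model_terminates_iff (BAUML.Arith.halting_over n),
      BAUML.Arith.hasFiniteModel_halting_iff]
  have hcode : Primrec fun n => (B n).code :=
    BAUML.Reduction.primrec_code_model _ (BAUML.Arith.primrec_code_halting c 3)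
  exact hc (ComputablePred.computable_iff.2
    ⟨fun n => f (B n).code, hf.comp hcode.to_comp, funext fun n => propext (hB n).symm⟩)
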